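/- **Setting.** Let $V=(1,\dots,d)$ be the ordered node set of a parent graph, that is, of a directed acyclic graph in which an arrow $i\leftarrow k$ is possible only for $i<k$. Its edge matrix $\mathcal A$ is the $d\times d$ matrix with $\mathcal A_{ik}=1$ if $i=k$ or $i\leftarrow k$, and $\mathcal A_{ik}=0$ otherwise. For a real matrix $F$, $\operatorname{In}[F]$ is obtained by changing every non-zero entry into a one, and $F_{ab}$ is the submatrix with rows $a$ and columns $b$. For a subset $a$ of the index set with complement $b$, and $d_a$ the number of elements of $a$, partial inversion and partial closure are $$\operatorname{inv}_aF=\begin{pmatrix}F_{aa}^{-1}&-F_{aa}^{-1}F_{ab}\\F_{ba}F_{aa}^{-1}&F_{bb}-F_{ba}F_{aa}^{-1}F_{ab}\end{pmatrix},\qquad \operatorname{zer}_a\mathcal F=\operatorname{In}\left[\begin{pmatrix}\mathcal F_{aa}^{-}&\mathcal F_{aa}^{-}\mathcal F_{ab}\\\mathcal F_{ba}\mathcal F_{aa}^{-}&\mathcal F_{bb}+\mathcal F_{ba}\mathcal F_{aa}^{-}\mathcal F_{ab}\end{pmatrix}\right],$$ $$\mathcal F_{aa}^{-}=\operatorname{In}[((d_a+1)I_{aa}-\mathcal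 F_{aa})^{-1}].$$ Let $C$ and $M$ be disjoint subsets of $V$ (conditioning and marginalising set). Let $F$ be the set of ancestors of nodes of $C$ that lie outside $C$, $R=C\cup F$, $O=V\setminus R$, $u=O\setminus M$, $v=F\setminus M$, $p=O\setminus u$, $q=F\setminus v$ and $N=u\cup v$. A Gaussian triangular system generated over the parent graph is given by a real unit upper-triangular matrix $A$ with $\operatorname{In}[A]=\mathcal A$ and a diagonal matrix $\Delta$ with positive diagonal, through $AY=\varepsilon$, $\operatorname{cov}(\varepsilon)=\Delta$, so that $\operatorname{cov}(Y)=\Sigma=A^{-1}\Delta A^{-\mathrm T}$. Put $$D=\operatorname{inv}_pA,\qquad \Sigma^{FF.O}=[(\Sigma_{RR})^{-1}]_{F,F},\qquad \operatorname{inv}_q\Sigma^{FF.O}=\begin{pmatrix}\Sigma_{qq|vC}&\Pi_{q|v.C}\\\sim&\Sigma^{vv.uM}\end{pmatrix},$$ $$H_{uu}=D_{uu},\qquad H_{uv}=D_{uv}+D_{uq}\Pi_{q|v.C},\qquad W_{uu}=(\Delta_{uu}+D_{up}\Delta_{pp}D_{up}^{\mathrm T})+D_{uq}\Sigma_{qq|vC}D_{uq}^{\mathrm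 T}.$$ The edge matrices $\mathcal H_{uu},\mathcal H_{uv},\mathcal S^{vv.uM},\mathcal W_{uu}$ of the summary graph $G^{V\setminus[C,M]}_{\mathrm{sum}}$ are the binary matrices of structural zeros of $H_{uu},H_{uv},\Sigma^{vv.uM},W_{uu}$: an entry is $0$ if the corresponding parameter entry vanishes for every Gaussian triangular system generated over the parent graph, and $1$ otherwise. **Corollary 4.** (i) For every Gaussian triangular system generated over the parent graph, these parameters form a Gaussian summary graph model for $Y_{N|C}$: $H_{uu}$ is unit upper-triangular, $W_{uu}$ and $\Sigma^{vv.uM}$ are symmetric positive definite, $\Sigma^{vv.uM}=\Sigma_{vv|C}^{-1}$, and with $H=\begin{pmatrix}H_{uu}&H_{uv}\\0&\Sigma^{vv.uM}\end{pmatrix}$ and $\Sigma_{NN|C}=\Sigma_{NN}-\Sigma_{NC}\Sigma_{CC}^{-1}\Sigma_{CN}$, $$\operatorname{cov}(HY_{N|C})=H\,\Sigma_{NN|C}\,H^{\mathrm T}=\begin{pmatrix}W_{uu}&0\\0&\Sigma^{vv.uM}\end{pmatrix}.$$ (ii) Let $\mathcal D=\operatorname{zer}_p\mathcal A$, let $\mathcal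 S^{FF.O}$ be the $(F,F)$ block of $\operatorname{In}[\mathcal A_{RR}^{\mathrm T}\mathcal A_{RR}]$, and denote the $(q,q)$, $(q,v)$ and $(v,v)$ blocks of $\operatorname{zer}_q\mathcal S^{FF.O}$ by $\mathcal S_{qq|vC}$, $\mathcal P_{q|v.C}$ and $\mathcal S^{vv.qO}$. Then the edge matrices of the summary graph are $$\mathcal H_{uu}=\mathcal D_{uu},\qquad \mathcal H_{uv}=\operatorname{In}[\mathcal D_{uv}+\mathcal D_{uq}\mathcal P_{q|v.C}],\qquad \mathcal S^{vv.uM}=\mathcal S^{vv.qO},$$ $$\mathcal W_{uu}=\operatorname{In}[(I_{uu}+\mathcal D_{up}\mathcal D_{up}^{\mathrm T})+\mathcal D_{uq}\mathcal S_{qq|vC}\mathcal D_{uq}^{\mathrm T}].$$ -/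

import Mathlib

open Matrix

noncomputable section

namespace SummaryGraph

/-! ### Submatrices, indicator matrices, partial inversion and partial closure -/

/-- The submatrix `F_{ab}` of a square matrix `F`. -/
def blk {n : Type*} (F : Matrix n n ℝ) (a b : Finset n) : Matrix a b ℝ :=
  F.submatrix (fun i => (i : n)) (fun j => (j : n))

/-- The inclusion of a node set in a larger one. -/
def incl {n : Type*} {s t : Finset n} (h : s ⊆ t) : s → t := fun x => ⟨x.1, h x.2⟩

open Classical in
/-- `In[F]` changes every non-zero entry of a matrix into a one. -/
def In {m n : Type*} (F : Matrix m n ℝ) : Matrix m n ℝ :=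
  Matrix.of fun i j => if F i j = 0 then 0 else 1

/-- The square matrix whose four blocks, with respect to the split of the index set into `a`
and its complement, are the given ones; the rows and columns stay in their places. -/
def assemble {n : Type*} [Fintype n] [DecidableEq n] (a : Finset n)
    (Faa : Matrix a a ℝ) (Fab : Matrix a (aᶜ : Finset n) ℝ)
    (Fba : Matrix (aᶜ : Finset n) a ℝ) (Fbb : Matrix (aᶜ : Finset n) (aᶜ : Finset n) ℝ) :
    Matrix n n ℝ :=
  Matrix.of fun i j =>
    if hi : i ∈ a then
      if hj : j ∈ a then Faa ⟨i, hi⟩ ⟨j, hj⟩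
      else Fab ⟨i, hi⟩ ⟨j, Finset.mem_compl.2 hj⟩
    else
      if hj : j ∈ a then Fba ⟨i, Finset.mem_compl.2 hi⟩ ⟨j, hj⟩
      else Fbb ⟨i, Finset.mem_compl.2 hi⟩ ⟨j, Finset.mem_compl.2 hj⟩

/-- Partial inversion `inv_a F`. -/
def partialInv {n : Type*} [Fintype n] [DecidableEq n] (a : Finset n) (F : Matrix n n ℝ) :
    Matrix n n ℝ :=
  assemble a
    (blk F a a)⁻¹
    (-((blk F a a)⁻¹ * blk F a aᶜ))
    (blk F aᶜ a * (blk F a a)⁻¹)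
    (blk F aᶜ aᶜ - blk F aᶜ a * (blk F a a)⁻¹ * blk F a aᶜ)

/-- `F_aa^- = In[((d_a + 1) I - F_aa)⁻¹]`, where `d_a` is the number of elements of `a`. -/
def closure {n : Type*} [DecidableEq n] (a : Finset n) (F : Matrix n n ℝ) : Matrix a a ℝ :=
  In ((((a.card : ℝ) + 1) • (1 : Matrix a a ℝ) - blk F a a)⁻¹)

/-- Partial closure `zer_a F` of an edge matrix. -/
def partialClosure {n : Type*} [Fintype n] [DecidableEq n] (a : Finset n) (F : Matrix n n ℝ) :
    Matrix n n ℝ :=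
  In (assemble a
    (closure a F)
    (closure a F * blk F a aᶜ)
    (blk F aᶜ a * closure a F)
    (blk F aᶜ aᶜ + blk F aᶜ a * closure a F * blk F a aᶜ))

/-! ### Parent graphs and the node sets defined by conditioning and marginalising -/

/-- A directed acyclic graph on the ordered node set `V = (1, …, d)`, with a compatible ordering:
`edge i k` means that there is an arrow from `k` to `i`, and then `i < k`.
Connectedness is not required. -/
structure ParentGraph (d : ℕ) where
  edge : Fin d → Fin d → Prop
  lt_of_edge : ∀ i k, edge i k → i < k

namespace ParentGraph

variable {d : ℕ} (G : ParentGraph d) (C M : Finset (Fin d))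

open Classical in
/-- The unit upper-triangular edge matrix of the parent graph. -/
def edgeMatrix : Matrix (Fin d) (Fin d) ℝ :=
  Matrix.of fun i k => if i = k ∨ G.edge i k then 1 else 0

/-- `k` is an ancestor of `i`: there is a path `i ← ⋯ ← k` with at least one arrow. -/
def IsAncestor (k i : Fin d) : Prop := Relation.TransGen G.edge i k

open Classical in
/-- The foster nodes `F` of `C`: the ancestors of `C` outside `C`. -/
def foster : Finset (Fin d) :=
  Finset.univ.filter fun k => k ∉ C ∧ ∃ c ∈ C, G.IsAncestor k c

/-- `R = C ∪ F`. -/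
def right : Finset (Fin d) := C ∪ G.foster C

/-- The outsiders `O = V ∖ R`. -/
def outsiders : Finset (Fin d) := (G.right C)ᶜ

/-- `u = O ∖ M`. -/
def u : Finset (Fin d) := G.outsiders C \ M

/-- `v = F ∖ M`. -/
def v : Finset (Fin d) := G.foster C \ M

/-- `p = O ∖ u`, the outsiders to be marginalised over. -/
def p : Finset (Fin d) := G.outsiders C \ G.u C M

/-- `q = F ∖ v`, the foster nodes to be marginalised over. -/
def q : Finset (Fin d) := G.foster C \ G.v C M

theorem foster_subset_right : G.foster C ⊆ G.right C := Finset.subset_union_right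

theorem q_subset_foster : G.q C M ⊆ G.foster C := Finset.sdiff_subset

theorem v_subset_foster : G.v C M ⊆ G.foster C := Finset.sdiff_subset

/-- The set `q`, as a set of elements of `F`. -/
def qF : Finset (G.foster C) := (G.q C M).subtype (· ∈ G.foster C)

/-! ### Gaussian triangular systems over the parent graph and their parameters -/

/-- `A Y = ε` with `cov ε = diag δ` is a non-degenerate linear triangular system generated over
the parent graph: `A` is unit upper-triangular with exactly the zeros of the edge matrix. -/
structure IsTriangularSystem (A : Matrix (Fin d) (Fin d) ℝ) (δ : Fin d → ℝ) : Prop where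
  diag : ∀ i, A i i = 1
  indicator : In A = G.edgeMatrix
  pos : ∀ i, 0 < δ i

end ParentGraph

/-- The covariance matrix `Σ = A⁻¹ Δ A⁻ᵀ` of `Y` when `A Y = ε`, `cov ε = Δ = diag δ`. -/
def cov {d : ℕ} (A : Matrix (Fin d) (Fin d) ℝ) (δ : Fin d → ℝ) : Matrix (Fin d) (Fin d) ℝ :=
  A⁻¹ * diagonal δ * (A⁻¹)ᵀ

/-- The conditional covariance matrix `Σ_{NN|C}` of `(Y_u, Y_v)` given `Y_C`, that is, the
covariance matrix of the residual `Y_{N|C}`, for `N = (u, v)`. -/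
def condCov {d : ℕ} (S : Matrix (Fin d) (Fin d) ℝ) (u v C : Finset (Fin d)) :
    Matrix (u ⊕ v) (u ⊕ v) ℝ :=
  let f : u ⊕ v → Fin d := Sum.elim (fun i => i.1) (fun i => i.1)
  let g : C → Fin d := fun i => i.1
  S.submatrix f f - S.submatrix f g * (blk S C C)⁻¹ * S.submatrix g f

/-- Gaussian summary graph model for `Y_{N|C}`, `N = (u, v)`, with covariance matrix `S`: the
system `H Y_{N|C} = (η_u, ζ_v)` with `H = ((H_uu, H_uv), (0, K))` is block-triangular and
orthogonal in `(u, v)`, with `cov (η_u, ζ_v) = diag (W_uu, K)`, where `H_uu` is unit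
upper-triangular and `K` is the concentration matrix of `Y_{v|C}`. -/
structure IsGaussianSummaryModel {d : ℕ} {u v : Finset (Fin d)} (S : Matrix (u ⊕ v) (u ⊕ v) ℝ)
    (Huu : Matrix u u ℝ) (Huv : Matrix u v ℝ) (K : Matrix v v ℝ) (Wuu : Matrix u u ℝ) : Prop where
  diag : ∀ i, Huu i i = 1
  upper : ∀ i k : u, k.1 < i.1 → Huu i k = 0
  posDef_W : Wuu.PosDef
  posDef_K : K.PosDef
  concentration : K = (S.toBlocks₂₂)⁻¹
  residual : fromBlocks Huu Huv 0 K * S * (fromBlocks Huu Huv 0 K)ᵀ = fromBlocks Wuu 0 0 K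

namespace ParentGraph

variable {d : ℕ} (G : ParentGraph d) (C M : Finset (Fin d))
  (A : Matrix (Fin d) (Fin d) ℝ) (δ : Fin d → ℝ)

/-- `D = inv_p A`. -/
def paramD : Matrix (Fin d) (Fin d) ℝ := partialInv (G.p C M) A

/-- `Σ^{FF.O}`: the `(F, F)` block of the concentration matrix `Σ^{RR.O} = Σ_RR⁻¹` of `Y_R`. -/
def conFF : Matrix (G.foster C) (G.foster C) ℝ :=
  ((blk (cov A δ) (G.right C) (G.right C))⁻¹).submatrix
    (incl (G.foster_subset_right C)) (incl (G.foster_subset_right C))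

/-- `inv_q Σ^{FF.O}`, with the blocks `Σ_{qq|vC}`, `Π_{q|v.C}` and `Σ^{vv.qO}`. -/
def invConFF : Matrix (G.foster C) (G.foster C) ℝ := partialInv (G.qF C M) (G.conFF C A δ)

/-- `Σ_{qq|vC}`. -/
def sigmaQQ : Matrix (G.q C M) (G.q C M) ℝ :=
  (G.invConFF C M A δ).submatrix (incl (G.q_subset_foster C M)) (incl (G.q_subset_foster C M))

/-- `Π_{q|v.C}`. -/
def piQV : Matrix (G.q C M) (G.v C M) ℝ :=
  (G.invConFF C M A δ).submatrix (incl (G.q_subset_foster C M)) (incl (G.v_subset_foster C M))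

/-- `Σ^{vv.qO} = Σ^{vv.uM}`. -/
def sigmaVV : Matrix (G.v C M) (G.v C M) ℝ :=
  (G.invConFF C M A δ).submatrix (incl (G.v_subset_foster C M)) (incl (G.v_subset_foster C M))

/-- `H_uu = D_uu`. -/
def paramHuu : Matrix (G.u C M) (G.u C M) ℝ := blk (G.paramD C M A) (G.u C M) (G.u C M)

/-- `H_uv = D_uv + D_uq Π_{q|v.C}`. -/
def paramHuv : Matrix (G.u C M) (G.v C M) ℝ :=
  blk (G.paramD C M A) (G.u C M) (G.v C M)
    + blk (G.paramD C M A) (G.u C M) (G.q C M) * G.piQV C M A δ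

/-- `W_uu = (Δ_uu + D_up Δ_pp D_upᵀ) + D_uq Σ_{qq|vC} D_uqᵀ`. -/
def paramWuu : Matrix (G.u C M) (G.u C M) ℝ :=
  (blk (diagonal δ) (G.u C M) (G.u C M)
    + blk (G.paramD C M A) (G.u C M) (G.p C M) * blk (diagonal δ) (G.p C M) (G.p C M)
      * (blk (G.paramD C M A) (G.u C M) (G.p C M))ᵀ)
    + blk (G.paramD C M A) (G.u C M) (G.q C M) * G.sigmaQQ C M A δ
      * (blk (G.paramD C M A) (G.u C M) (G.q C M))ᵀ

/-! ### The summary graph -/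

open Classical in
/-- The edge matrix of structural zeros of a parameter matrix `X`: the entry `(i, k)` is zero if
and only if `X_ik` vanishes for every triangular system generated over the parent graph. -/
def structuralEdgeMatrix {m n : Type*}
    (X : Matrix (Fin d) (Fin d) ℝ → (Fin d → ℝ) → Matrix m n ℝ) : Matrix m n ℝ :=
  Matrix.of fun i k => if ∀ A δ, G.IsTriangularSystem A δ → X A δ i k = 0 then 0 else 1

end ParentGraph

/-- The four edge matrix components of a summary graph in node set `N = (u, v)`: arrows within
`u`, arrows from `v` to `u`, full lines within `v`, dashed lines within `u`. -/
structure SummaryEdgeMatrices {d : ℕ} (u v : Finset (Fin d)) where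
  Huu : Matrix u u ℝ
  Huv : Matrix u v ℝ
  Svv : Matrix v v ℝ
  Wuu : Matrix u u ℝ

namespace ParentGraph

variable {d : ℕ} (G : ParentGraph d) (C M : Finset (Fin d))

/-- The summary graph induced by the parent graph after conditioning on `C` and marginalising
over `M`: its missing edges are the structural zeros of the parameters of the Gaussian summary
graph model. -/
def summaryGraph : SummaryEdgeMatrices (G.u C M) (G.v C M) where
  Huu := G.structuralEdgeMatrix fun A _ => G.paramHuu C M A
  Huv := G.structuralEdgeMatrix fun A δ => G.paramHuv C M A δ
  Svv := G.structuralEdgeMatrix fun A δ => G.sigmaVV C M A δ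
  Wuu := G.structuralEdgeMatrix fun A δ => G.paramWuu C M A δ

/-! ### Edge matrices obtained by partial closure from the edge matrix of the parent graph -/

/-- `zer_p` of the edge matrix of the parent graph. -/
def edgeD : Matrix (Fin d) (Fin d) ℝ := partialClosure (G.p C M) G.edgeMatrix

/-- The edge matrix of the marginal concentration graph of `Y_R` is `In[𝒜_RRᵀ 𝒜_RR]`; this is
its `(F, F)` block. -/
def edgeConFF : Matrix (G.foster C) (G.foster C) ℝ :=
  (In ((blk G.edgeMatrix (G.right C) (G.right C))ᵀ
    * blk G.edgeMatrix (G.right C) (G.right C))).submatrix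
    (incl (G.foster_subset_right C)) (incl (G.foster_subset_right C))

/-- `zer_q` of the edge matrix of the marginal concentration graph on `F`. -/
def zerConFF : Matrix (G.foster C) (G.foster C) ℝ := partialClosure (G.qF C M) (G.edgeConFF C)

/-- The block `(q, q)` of the closed matrix, written `S_{qq|vC}`. -/
def edgeSqq : Matrix (G.q C M) (G.q C M) ℝ :=
  (G.zerConFF C M).submatrix (incl (G.q_subset_foster C M)) (incl (G.q_subset_foster C M))

/-- The block `(q, v)` of the closed matrix, written `P_{q|v.C}`. -/
def edgePqv : Matrix (G.q C M) (G.v C M) ℝ :=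
  (G.zerConFF C M).submatrix (incl (G.q_subset_foster C M)) (incl (G.v_subset_foster C M))

/-- The block `(v, v)` of the closed matrix, written `S^{vv.qO} = S^{vv.uM}`. -/
def edgeSvv : Matrix (G.v C M) (G.v C M) ℝ :=
  (G.zerConFF C M).submatrix (incl (G.v_subset_foster C M)) (incl (G.v_subset_foster C M))

end ParentGraph

end SummaryGraph

end

/-! Everything rests on `R = C ∪ F` being closed under taking parents. Hence `A` has no entries from
rows in `R` to columns outside `R`, `Y_R` depends on the errors of `R` only, and the errors of `O`
are uncorrelated with `Y_R`.

For the model, take the equations of `u`, eliminate `Y_p` through `inv_p A`, and replace `Y_q` by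
its regression on `Y_v` given `Y_C`. The residual is `ε_u - D_up ε_p - D_uq (Y_q - Π_{q|v.C} Y_v)`,
with mutually uncorrelated parts, also uncorrelated with `Y_v` given `Y_C`; its covariance is
`W_uu`. See `sum_paramD_mul`, `mul_residualCov` and `fromBlocks_mul_mul_transpose_eq`.

For the edge matrices, one inclusion is combinatorial: a non-zero entry of an inverse forces a walk
in the support (`reflTransGen_of_inv_ne_zero`), and partial closure records exactly the walks
through the closed set.

The converse needs, for each entry allowed by the edge matrices, a system in which nothing cancels.
Put `A_ik = 1` on arrows into `R ∖ q = C ∪ v` and `A_ik = -1` on all other arrows, with variance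
`1/s` on `R ∖ q` and `1` elsewhere. Then `T = A_qq⁻¹` and `E = A_{R∖q,q} T` are non-negative, the
concentration matrix on `q` is `A_qqᵀ A_qq + s A_{R∖q,q}ᵀ A_{R∖q,q}`, and its inverse is `T (1 + s
EᵀE)⁻¹ Tᵀ`. The other parameters are built from the same resolvent. As a formal series in `s` it
alternates in sign, but the coefficient of each single power is, up to sign, a product of
non-negative matrices, positive when a walk of that length exists. An entry vanishing for every `s >
0` would make all coefficients vanish (`mul_pow_mul_eq_zero_of_resolvent`), so some `s` gives a
non-zero entry.

Walks in the concentration graph must finally become walks of `EᵀE`. This uses that each node of `q`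
is an ancestor of `C`, hence has a positive effect on some node of `R ∖ q` (`exists_testE_pos`,
`Linked.trans`). -/

noncomputable section

namespace SummaryGraph

/-! ### Supports of inverse matrices -/

section Inverse

variable {m : Type*} [Fintype m] [DecidableEq m]

/-- The support of an inverse matrix is contained in the reflexive transitive closure of the
support of the matrix. -/
theorem reflTransGen_of_inv_ne_zero {X : Matrix m m ℝ} {r : m → m → Prop}
    (h : ∀ i j, X i j ≠ 0 → r i j) {i j : m} (hij : X⁻¹ i j ≠ 0) :
    Relation.ReflTransGen r i j := by
  classical
  by_contra hne
  by_cases hX : IsUnit X.det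
  · let := Matrix.invertibleOfIsUnitDet X hX
    -- Label `0` the indices that reach `j`. No non-zero entry leads from label `1` to label `0`, so
    -- `X` is block triangular, and inversion preserves this.
    let b : m → ℕ := fun x => if Relation.ReflTransGen r x j then 0 else 1
    have hb : X.BlockTriangular b := by
      intro x y hxy
      by_contra hne'
      have h1 := h x y hne'
      simp only [b] at hxy
      split_ifs at hxy with h2 h3
      all_goals first | omega | exact h3 (Relation.ReflTransGen.head h1 h2)
    have h2 := blockTriangular_inv_of_blockTriangular hb
    refine hij (h2 ?_)
    simp [b, hne, Relation.ReflTransGen.refl]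
  · rw [Matrix.nonsing_inv_apply_not_isUnit X hX] at hij
    exact hij rfl

/-- If the off-diagonal entries of `X` are non-positive and its inverse is non-negative, then the
inverse is positive along every walk in the support of `X`. -/
theorem inv_pos_of_reflTransGen {X : Matrix m m ℝ} (hX : IsUnit X.det)
    (hdiag : ∀ i, 0 < X i i) (hoff : ∀ i j, i ≠ j → X i j ≤ 0) (hinv : ∀ i j, 0 ≤ X⁻¹ i j)
    {i j : m} (hij : Relation.ReflTransGen (fun i j => X i j ≠ 0) i j) : 0 < X⁻¹ i j := by
  -- Row `i` of `X X⁻¹ = 1`, arranged so that every term on the right is non-negative and one edge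
  -- of the walk gives a positive term.
  have key : ∀ i, X i i * X⁻¹ i j
      = (1 : Matrix m m ℝ) i j + ∑ k ∈ Finset.univ.erase i, (-X i k) * X⁻¹ k j := by
    intro i
    rw [← Matrix.mul_nonsing_inv X hX, Matrix.mul_apply,
      ← Finset.add_sum_erase _ _ (Finset.mem_univ i)]
    simp
  have hterm : ∀ i, ∀ k ∈ Finset.univ.erase i, 0 ≤ (-X i k) * X⁻¹ k j := fun i k hk =>
    mul_nonneg (neg_nonneg.2 (hoff i k (Finset.ne_of_mem_erase hk).symm)) (hinv k j)
  induction hij using Relation.ReflTransGen.head_induction_on with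
  | refl =>
    have h1 := key j
    have h2 := Finset.sum_nonneg (hterm j)
    rw [Matrix.one_apply_eq] at h1
    exact pos_of_mul_pos_right (by linarith : 0 < X j j * X⁻¹ j j) (hdiag j).le
  | @head i k hik _ ih =>
    by_cases heq : i = k
    · rwa [heq]
    · have h1 := key i
      have h2 := Finset.single_le_sum (hterm i)
        (Finset.mem_erase.2 ⟨Ne.symm heq, Finset.mem_univ k⟩)
      have h3 : 0 < (-X i k) * X⁻¹ k j :=
        mul_pos (neg_pos.2 (lt_of_le_of_ne (hoff i k heq) hik)) ih
      have h4 : 0 ≤ (1 : Matrix m m ℝ) i j := by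
        rw [Matrix.one_apply]; split_ifs <;> norm_num
      exact pos_of_mul_pos_right (by linarith : 0 < X i i * X⁻¹ i j) (hdiag i).le

/-- A unit upper-triangular matrix is invertible. -/
theorem isUnit_det_of_unitUpper [LinearOrder m] {X : Matrix m m ℝ} (hdiag : ∀ i, X i i = 1)
    (hupper : ∀ i j, j < i → X i j = 0) : IsUnit X.det := by
  have h : X.BlockTriangular id := fun i j hij => hupper i j hij
  rw [Matrix.det_of_isUpperTriangular h]
  simp [hdiag]

/-- The inverse of a unit upper-triangular matrix with non-positive off-diagonal entries is
non-negative. -/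
theorem inv_nonneg_of_unitUpper [LinearOrder m] {X : Matrix m m ℝ} (hdiag : ∀ i, X i i = 1)
    (hupper : ∀ i j, j < i → X i j = 0) (hoff : ∀ i j, i ≠ j → X i j ≤ 0) (i j : m) :
    0 ≤ X⁻¹ i j := by
  have hX := isUnit_det_of_unitUpper hdiag hupper
  -- Back substitution: row `i` of the inverse involves later rows only.
  induction i using WellFoundedGT.induction with
  | ind i ih =>
    have key : X⁻¹ i j
        = (1 : Matrix m m ℝ) i j + ∑ k ∈ Finset.univ.erase i, (-X i k) * X⁻¹ k j := by
      rw [← Matrix.mul_nonsing_inv X hX, Matrix.mul_apply,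
        ← Finset.add_sum_erase _ _ (Finset.mem_univ i)]
      simp [hdiag]
    rw [key]
    refine add_nonneg (by rw [Matrix.one_apply]; split_ifs <;> norm_num)
      (Finset.sum_nonneg fun k hk => ?_)
    have hne := Finset.ne_of_mem_erase hk
    rcases lt_or_gt_of_ne hne with hlt | hgt
    · simp [hupper i k hlt]
    · exact mul_nonneg (neg_nonneg.2 (hoff i k hne.symm)) (ih k hgt)

/-- A matrix with entries in `[0, 1]` is shifted to an invertible matrix by the multiple
`d + 1` of the identity, where `d` is its size, and the inverse is non-negative. -/
theorem isUnit_det_shift_and_inv_nonneg {F : Matrix m m ℝ} (h0 : ∀ i j, 0 ≤ F i j)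
    (h1 : ∀ i j, F i j ≤ 1) :
    IsUnit (((Fintype.card m : ℝ) + 1) • (1 : Matrix m m ℝ) - F).det ∧
      ∀ i j, 0 ≤ (((Fintype.card m : ℝ) + 1) • (1 : Matrix m m ℝ) - F)⁻¹ i j := by
  set X := ((Fintype.card m : ℝ) + 1) • (1 : Matrix m m ℝ) - F with hX
  have hunit : IsUnit X.det := by
    rw [isUnit_iff_ne_zero]
    -- Strict diagonal dominance: row sums of `F` are at most `d`, and the shift is `d + 1`.
    refine det_ne_zero_of_sum_row_lt_diag fun k => ?_
    have hcard : ∑ j, F k j ≤ Fintype.card m := by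
      calc ∑ j, F k j ≤ ∑ _j : m, (1 : ℝ) := Finset.sum_le_sum fun j _ => h1 k j
        _ = _ := by simp
    rw [← Finset.add_sum_erase _ _ (Finset.mem_univ k)] at hcard
    have hs : ∑ j ∈ Finset.univ.erase k, ‖X k j‖ = ∑ j ∈ Finset.univ.erase k, F k j := by
      refine Finset.sum_congr rfl fun j hj => ?_
      rw [hX]
      simp [Matrix.one_apply_ne (Finset.ne_of_mem_erase hj).symm, abs_of_nonneg (h0 k j)]
    have hd : ((Fintype.card m : ℝ) + 1) - F k k ≤ ‖X k k‖ := by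
      rw [hX]
      simpa using le_abs_self (((Fintype.card m : ℝ) + 1) - F k k)
    rw [hs]
    linarith
  refine ⟨hunit, fun i j => ?_⟩
  -- Minimum principle: if the least entry `x` of column `j` were negative, its row would give `(d +
  -- 1) x ≥ d x`, a contradiction.
  obtain ⟨i₀, -, hmin⟩ := Finset.exists_min_image Finset.univ (fun i => X⁻¹ i j)
    ⟨i, Finset.mem_univ i⟩
  refine le_trans ?_ (hmin i (Finset.mem_univ i))
  have key : ((Fintype.card m : ℝ) + 1) * X⁻¹ i₀ j
      = (1 : Matrix m m ℝ) i₀ j + ∑ k, F i₀ k * X⁻¹ k j := by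
    have h2 : (X * X⁻¹) i₀ j = (1 : Matrix m m ℝ) i₀ j := by rw [Matrix.mul_nonsing_inv X hunit]
    have h3 : X * X⁻¹ = ((Fintype.card m : ℝ) + 1) • X⁻¹ - F * X⁻¹ := by
      nth_rewrite 1 [hX]
      rw [Matrix.sub_mul, Matrix.smul_mul, Matrix.one_mul]
    rw [h3, Matrix.sub_apply, Matrix.smul_apply, smul_eq_mul, Matrix.mul_apply] at h2
    linarith
  by_contra hneg
  push Not at hneg
  have h4 : ∑ k, F i₀ k * X⁻¹ i₀ j ≤ ∑ k, F i₀ k * X⁻¹ k j :=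
    Finset.sum_le_sum fun k _ => mul_le_mul_of_nonneg_left (hmin k (Finset.mem_univ k)) (h0 _ _)
  have h5 : ∑ _k : m, X⁻¹ i₀ j ≤ ∑ k, F i₀ k * X⁻¹ i₀ j :=
    Finset.sum_le_sum fun k _ => by nlinarith [h1 i₀ k, h0 i₀ k]
  have h6 : 0 ≤ (1 : Matrix m m ℝ) i₀ j := by
    rw [Matrix.one_apply]; split_ifs <;> norm_num
  simp at h5
  nlinarith

end Inverse

/-! ### Supports of partial closures and partial inverses -/

section Closure

variable {n : Type*} [DecidableEq n]

theorem blk_apply {n : Type*} (F : Matrix n n ℝ) (a b : Finset n) (i : a) (j : b) :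
    blk F a b i j = F i j := rfl

theorem In_ne_zero_iff {m n : Type*} {F : Matrix m n ℝ} {i : m} {j : n} :
    In F i j ≠ 0 ↔ F i j ≠ 0 := by
  simp [In]

theorem In_nonneg {m n : Type*} (F : Matrix m n ℝ) (i : m) (j : n) : 0 ≤ In F i j := by
  simp only [In, Matrix.of_apply]; split_ifs <;> norm_num

theorem In_le_one {m n : Type*} (F : Matrix m n ℝ) (i : m) (j : n) : In F i j ≤ 1 := by
  simp only [In, Matrix.of_apply]; split_ifs <;> norm_num

/-- `i` and `k` are joined by a walk within `a` in the support of `F`. -/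
def Reach (a : Finset n) (F : Matrix n n ℝ) (i k : n) : Prop :=
  ∃ (hi : i ∈ a) (hk : k ∈ a),
    Relation.ReflTransGen (fun x y : a => F x y ≠ 0) ⟨i, hi⟩ ⟨k, hk⟩

theorem closure_nonneg (a : Finset n) (F : Matrix n n ℝ) (x y : a) : 0 ≤ closure a F x y :=
  In_nonneg _ _ _

/-- The shifted matrix has non-positive off-diagonal entries and a non-negative inverse, so its
inverse is positive exactly along walks; the shift changes the support only on the diagonal, which
reflexivity of walks absorbs. -/
theorem closure_ne_zero_iff {a : Finset n} {F : Matrix n n ℝ} (h0 : ∀ i j, 0 ≤ F i j)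
    (h1 : ∀ i j, F i j ≤ 1) {x y : a} : closure a F x y ≠ 0 ↔ Reach a F x y := by
  unfold closure
  rw [In_ne_zero_iff]
  have hs := isUnit_det_shift_and_inv_nonneg (F := blk F a a) (fun i j => h0 _ _)
    (fun i j => h1 _ _)
  rw [Fintype.card_coe] at hs
  have hR : Reach a F x y ↔ Relation.ReflTransGen (fun x y : a => F x y ≠ 0) x y :=
    ⟨fun ⟨_, _, h⟩ => h, fun h => ⟨x.2, y.2, h⟩⟩
  rw [hR]
  -- An index set with an element has `d_a ≥ 1`, so the shifted diagonal `d_a + 1 - F_ii` stays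
  -- positive.
  have hcard : ∀ i : a, (1 : ℝ) ≤ a.card := fun i => by
    exact_mod_cast Finset.card_pos.2 ⟨i.1, i.2⟩
  constructor
  · intro h
    have h2 := reflTransGen_of_inv_ne_zero (r := fun x y : a => x = y ∨ F x y ≠ 0)
      (fun i j hij => by
      by_contra hc
      push Not at hc
      apply hij
      simp [Matrix.one_apply_ne hc.1, blk, hc.2]) h
    refine Relation.ReflTransGen.lift' id (fun b c hbc => ?_) _ _ h2
    rcases hbc with rfl | hbc
    · exact .refl
    · exact .single hbc
  · intro h
    refine (inv_pos_of_reflTransGen hs.1 (fun i => ?_) (fun i j hij => ?_) hs.2 ?_).ne'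
    · simp [blk]
      linarith [hcard i, h1 i i]
    · simp [Matrix.one_apply_ne hij, blk, h0]
    · refine Relation.ReflTransGen.lift' id (fun b c hbc => .single ?_) _ _ h
      by_cases hbc' : b = c
      · subst hbc'
        simp [blk]
        linarith [hcard b, h1 b b]
      · simpa [Matrix.one_apply_ne hbc', blk] using hbc

theorem sum_ne_zero_iff_of_nonneg {ι : Type*} [Fintype ι] {f : ι → ℝ} (h : ∀ i, 0 ≤ f i) :
    ∑ i, f i ≠ 0 ↔ ∃ i, f i ≠ 0 := by
  rw [Ne, Finset.sum_eq_zero_iff_of_nonneg fun i _ => h i]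
  simp

variable [Fintype n]

theorem partialClosure_nonneg (a : Finset n) (F : Matrix n n ℝ) (i j : n) :
    0 ≤ partialClosure a F i j := In_nonneg _ _ _

section Blocks

variable {a : Finset n} {F : Matrix n n ℝ} (h0 : ∀ i j, 0 ≤ F i j) (h1 : ∀ i j, F i j ≤ 1)
  {i k : n}

include h0 h1

/-- In this and the next three lemmas all summands are non-negative, so an entry is non-zero exactly
when some single walk contributes. -/
theorem partialClosure_mem_mem (hi : i ∈ a) (hk : k ∈ a) :
    partialClosure a F i k ≠ 0 ↔ Reach a F i k := by
  rw [partialClosure, In_ne_zero_iff]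
  simp only [assemble, Matrix.of_apply, hi, hk, dif_pos]
  exact closure_ne_zero_iff h0 h1

theorem partialClosure_mem_notMem (hi : i ∈ a) (hk : k ∉ a) :
    partialClosure a F i k ≠ 0 ↔ ∃ y, Reach a F i y ∧ F y k ≠ 0 := by
  rw [partialClosure, In_ne_zero_iff]
  simp only [assemble, Matrix.of_apply, hi, hk, dif_pos, dif_neg, not_false_eq_true,
    Matrix.mul_apply, blk_apply]
  rw [sum_ne_zero_iff_of_nonneg fun x => mul_nonneg (closure_nonneg _ _ _ _) (h0 _ _)]
  simp only [mul_ne_zero_iff, closure_ne_zero_iff h0 h1]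
  exact ⟨fun ⟨y, h⟩ => ⟨y, h⟩, fun ⟨y, h, h'⟩ => ⟨⟨y, h.2.1⟩, h, h'⟩⟩

theorem partialClosure_notMem_mem (hi : i ∉ a) (hk : k ∈ a) :
    partialClosure a F i k ≠ 0 ↔ ∃ x, F i x ≠ 0 ∧ Reach a F x k := by
  rw [partialClosure, In_ne_zero_iff]
  simp only [assemble, Matrix.of_apply, hi, hk, dif_pos, dif_neg, not_false_eq_true,
    Matrix.mul_apply, blk_apply]
  rw [sum_ne_zero_iff_of_nonneg fun x => mul_nonneg (h0 _ _) (closure_nonneg _ _ _ _)]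
  simp only [mul_ne_zero_iff, closure_ne_zero_iff h0 h1]
  exact ⟨fun ⟨y, h⟩ => ⟨y, h⟩, fun ⟨y, h, h'⟩ => ⟨⟨y, h'.1⟩, h, h'⟩⟩

theorem partialClosure_notMem_notMem (hi : i ∉ a) (hk : k ∉ a) :
    partialClosure a F i k ≠ 0 ↔
      F i k ≠ 0 ∨ ∃ x y, F i x ≠ 0 ∧ Reach a F x y ∧ F y k ≠ 0 := by
  rw [partialClosure, In_ne_zero_iff]
  simp only [assemble, Matrix.of_apply, hi, hk, dif_neg, not_false_eq_true,
    Matrix.mul_apply, Matrix.add_apply, blk_apply]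
  have hn : ∀ y : a, 0 ≤ ∑ x : a, F i x * closure a F x y :=
    fun y => Finset.sum_nonneg fun x _ => mul_nonneg (h0 _ _) (closure_nonneg _ _ _ _)
  have hn' := fun y : a => mul_nonneg (hn y) (h0 y k)
  rw [Ne, add_eq_zero_iff_of_nonneg (h0 _ _) (Finset.sum_nonneg fun y _ => hn' y), not_and_or]
  refine or_congr Iff.rfl ?_
  refine (sum_ne_zero_iff_of_nonneg hn').trans ?_
  constructor
  · rintro ⟨y, hy⟩
    rw [mul_ne_zero_iff, sum_ne_zero_iff_of_nonneg fun x =>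
      mul_nonneg (h0 _ _) (closure_nonneg _ _ _ _)] at hy
    obtain ⟨⟨x, hx⟩, hy⟩ := hy
    rw [mul_ne_zero_iff, closure_ne_zero_iff h0 h1] at hx
    exact ⟨x, y, hx.1, hx.2, hy⟩
  · rintro ⟨x, y, hx, hxy, hy⟩
    refine ⟨⟨y, hxy.2.1⟩, mul_ne_zero ?_ hy⟩
    rw [sum_ne_zero_iff_of_nonneg fun x => mul_nonneg (h0 _ _) (closure_nonneg _ _ _ _)]
    refine ⟨⟨x, hxy.1⟩, mul_ne_zero hx ?_⟩
    rwa [closure_ne_zero_iff h0 h1]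

/-- The support of a partial inverse is contained in the partial closure of the support. -/
theorem partialClosure_ne_zero_of_partialInv_ne_zero {X : Matrix n n ℝ}
    (hX : ∀ i j, X i j ≠ 0 → F i j ≠ 0) (h : partialInv a X i k ≠ 0) :
    partialClosure a F i k ≠ 0 := by
  have hinv : ∀ x y : a, (blk X a a)⁻¹ x y ≠ 0 → Reach a F x y := fun x y hxy =>
    ⟨x.2, y.2, reflTransGen_of_inv_ne_zero (fun i j hij => hX _ _ hij) hxy⟩
  by_cases hi : i ∈ a <;> by_cases hk : k ∈ a <;>
    simp only [partialInv, assemble, Matrix.of_apply, hi, hk, dif_pos, dif_neg,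
      not_false_eq_true] at h
  · rw [partialClosure_mem_mem h0 h1 hi hk]
    exact hinv _ _ h
  · rw [partialClosure_mem_notMem h0 h1 hi hk]
    rw [Matrix.neg_apply, neg_ne_zero, Matrix.mul_apply] at h
    obtain ⟨y, -, hy⟩ := Finset.exists_ne_zero_of_sum_ne_zero h
    rw [mul_ne_zero_iff] at hy
    exact ⟨y, hinv _ _ hy.1, hX _ _ hy.2⟩
  · rw [partialClosure_notMem_mem h0 h1 hi hk]
    rw [Matrix.mul_apply] at h
    obtain ⟨y, -, hy⟩ := Finset.exists_ne_zero_of_sum_ne_zero h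
    rw [mul_ne_zero_iff] at hy
    exact ⟨y, hX _ _ hy.1, hinv _ _ hy.2⟩
  · rw [partialClosure_notMem_notMem h0 h1 hi hk]
    rw [Matrix.sub_apply] at h
    by_cases hik : X i k = 0
    · right
      have h' : (blk X aᶜ a * (blk X a a)⁻¹ * blk X a aᶜ) ⟨i, Finset.mem_compl.2 hi⟩
          ⟨k, Finset.mem_compl.2 hk⟩ ≠ 0 := by
        intro hz
        apply h
        rw [hz, sub_zero]
        exact hik
      rw [Matrix.mul_apply] at h'
      obtain ⟨y, -, hy⟩ := Finset.exists_ne_zero_of_sum_ne_zero h'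
      rw [mul_ne_zero_iff, Matrix.mul_apply] at hy
      obtain ⟨x, -, hx⟩ := Finset.exists_ne_zero_of_sum_ne_zero hy.1
      rw [mul_ne_zero_iff] at hx
      exact ⟨x, y, hX _ _ hx.1, hinv _ _ hx.2, hX _ _ hy.2⟩
    · exact Or.inl (hX _ _ hik)

end Blocks

end Closure

/-! ### Partial inversion of a principal submatrix -/

section PartialInvSubtype

variable {n : Type*} [DecidableEq n] (K : Matrix n n ℝ) {s q v : Finset n}
  (hq : q ⊆ s) (hv : v ⊆ s) (hqv : Disjoint q v)

/-- The elements of `q`, as elements of `s`. -/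
def subtypeEquiv (hq : q ⊆ s) : q ≃ (q.subtype (· ∈ s) : Finset s) where
  toFun x := ⟨⟨x.1, hq x.2⟩, Finset.mem_subtype.2 x.2⟩
  invFun y := ⟨y.1.1, Finset.mem_subtype.1 y.2⟩
  left_inv _ := rfl
  right_inv _ := rfl

theorem inv_blk_subtype :
    (blk (blk K s s) (q.subtype (· ∈ s)) (q.subtype (· ∈ s)))⁻¹.submatrix
      (subtypeEquiv hq) (subtypeEquiv hq) = (blk K q q)⁻¹ := by
  rw [← Matrix.inv_submatrix_equiv]
  rfl

include hqv in
theorem incl_notMem_subtype (y : v) : incl hv y ∉ q.subtype (· ∈ s) := fun h =>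
  Finset.disjoint_left.1 hqv (Finset.mem_subtype.1 h) y.2

theorem incl_mem_subtype (x : q) : incl hq x ∈ q.subtype (· ∈ s) := Finset.mem_subtype.2 x.2

/-- Partial inversion of `Σ^{FF.O}` takes place on the subtype `F`; this and the next two lemmas
return its blocks to matrices indexed by `q` and `v` as subsets of the whole node set. -/
theorem partialInv_subtype_mem_mem :
    (partialInv (q.subtype (· ∈ s)) (blk K s s)).submatrix (incl hq) (incl hq)
      = (blk K q q)⁻¹ := by
  rw [← inv_blk_subtype K hq]
  ext x y
  simp only [Matrix.submatrix_apply, partialInv, assemble, Matrix.of_apply,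
    incl_mem_subtype hq, dif_pos]
  rfl

include hqv in
theorem partialInv_subtype_mem_notMem :
    (partialInv (q.subtype (· ∈ s)) (blk K s s)).submatrix (incl hq) (incl hv)
      = -((blk K q q)⁻¹ * blk K q v) := by
  rw [← inv_blk_subtype K hq]
  ext x y
  simp only [Matrix.submatrix_apply, partialInv, assemble, Matrix.of_apply,
    incl_mem_subtype hq, incl_notMem_subtype hv hqv, dif_pos, dif_neg, not_false_eq_true,
    Matrix.neg_apply, Matrix.mul_apply]
  rw [← (subtypeEquiv hq).sum_comp]
  rfl

include hq hqv in
theorem partialInv_subtype_notMem_notMem :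
    (partialInv (q.subtype (· ∈ s)) (blk K s s)).submatrix (incl hv) (incl hv)
      = blk K v v - blk K v q * (blk K q q)⁻¹ * blk K q v := by
  rw [← inv_blk_subtype K hq]
  ext x y
  simp only [Matrix.submatrix_apply, partialInv, assemble, Matrix.of_apply,
    incl_notMem_subtype hv hqv, dif_neg, not_false_eq_true,
    Matrix.sub_apply, Matrix.mul_apply]
  rw [← (subtypeEquiv hq).sum_comp]
  simp only [← (subtypeEquiv hq).sum_comp (fun z => _ * (blk (blk K s s) _ _)⁻¹ z _)]
  rfl

end PartialInvSubtype

namespace ParentGraph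

variable {d : ℕ} (G : ParentGraph d) {C M : Finset (Fin d)}
  {A : Matrix (Fin d) (Fin d) ℝ} {δ : Fin d → ℝ}

/-! ### The node sets -/

theorem edgeMatrix_ne_zero_iff {i k : Fin d} : G.edgeMatrix i k ≠ 0 ↔ i = k ∨ G.edge i k := by
  simp only [edgeMatrix, Matrix.of_apply]
  split_ifs with h <;> simp [h]

theorem edgeMatrix_nonneg (i k : Fin d) : 0 ≤ G.edgeMatrix i k := by
  simp only [edgeMatrix, Matrix.of_apply]; split_ifs <;> norm_num

theorem edgeMatrix_le_one (i k : Fin d) : G.edgeMatrix i k ≤ 1 := by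
  simp only [edgeMatrix, Matrix.of_apply]; split_ifs <;> norm_num

/-- A parent of a node of `C ∪ F` is in `C` or is itself an ancestor of `C`. -/
theorem mem_right_of_edge {i k : Fin d} (hi : i ∈ G.right C) (h : G.edge i k) :
    k ∈ G.right C := by
  classical
  by_cases hk : k ∈ C
  · exact Finset.mem_union_left _ hk
  · refine Finset.mem_union_right _ ?_
    simp only [foster, Finset.mem_filter, Finset.mem_univ, true_and]
    refine ⟨hk, ?_⟩
    rcases Finset.mem_union.1 hi with hi | hi
    · exact ⟨i, hi, .single h⟩
    · simp only [foster, Finset.mem_filter, Finset.mem_univ, true_and] at hi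
      obtain ⟨-, c, hc, hic⟩ := hi
      exact ⟨c, hc, hic.tail h⟩

theorem notMem_of_mem_foster {i : Fin d} (h : i ∈ G.foster C) : i ∉ C := by
  simp only [foster, Finset.mem_filter] at h
  exact h.2.1

theorem disjoint_q_v : Disjoint (G.q C M) (G.v C M) := Finset.sdiff_disjoint

theorem ne_of_mem_q_of_mem_v {i k : Fin d} (hi : i ∈ G.q C M) (hk : k ∈ G.v C M) : i ≠ k :=
  fun h => Finset.disjoint_left.1 G.disjoint_q_v hi (h ▸ hk)

theorem mem_right_iff {i : Fin d} : i ∈ G.right C ↔ i ∈ C ∨ i ∈ G.foster C := Finset.mem_union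

theorem mem_outsiders_iff_notMem {i : Fin d} : i ∈ G.outsiders C ↔ i ∉ G.right C :=
  Finset.mem_compl

theorem mem_outsiders_of_mem_u {i : Fin d} (h : i ∈ G.u C M) : i ∈ G.outsiders C :=
  (Finset.mem_sdiff.1 h).1

theorem mem_outsiders_of_mem_p {i : Fin d} (h : i ∈ G.p C M) : i ∈ G.outsiders C :=
  (Finset.mem_sdiff.1 h).1

theorem notMem_p_of_mem_u {i : Fin d} (h : i ∈ G.u C M) : i ∉ G.p C M := fun h' =>
  (Finset.mem_sdiff.1 h').2 h

theorem notMem_p_of_mem_right {i : Fin d} (h : i ∈ G.right C) : i ∉ G.p C M := fun h' =>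
  (G.mem_outsiders_iff_notMem.1 (G.mem_outsiders_of_mem_p h')) h

theorem mem_right_of_mem_q {i : Fin d} (h : i ∈ G.q C M) : i ∈ G.right C :=
  G.foster_subset_right C (G.q_subset_foster C M h)

theorem mem_right_of_mem_v {i : Fin d} (h : i ∈ G.v C M) : i ∈ G.right C :=
  G.foster_subset_right C (G.v_subset_foster C M h)

theorem notMem_u_of_mem_right {i : Fin d} (h : i ∈ G.right C) : i ∉ G.u C M := fun hu =>
  (G.mem_outsiders_iff_notMem.1 (G.mem_outsiders_of_mem_u hu)) h

/-! ### Triangular systems -/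

namespace IsTriangularSystem

variable {G} (hA : G.IsTriangularSystem A δ)

include hA

theorem ne_zero_iff {i k : Fin d} : A i k ≠ 0 ↔ i = k ∨ G.edge i k := by
  rw [← G.edgeMatrix_ne_zero_iff, ← hA.indicator, In_ne_zero_iff]

theorem edgeMatrix_ne_zero {i k : Fin d} (h : A i k ≠ 0) : G.edgeMatrix i k ≠ 0 := by
  rwa [← hA.indicator, In_ne_zero_iff]

theorem eq_zero_of_lt {i k : Fin d} (h : k < i) : A i k = 0 := by
  by_contra hne
  rcases hA.ne_zero_iff.1 hne with rfl | he
  · exact lt_irrefl _ h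
  · exact lt_asymm h (G.lt_of_edge _ _ he)

theorem eq_zero_of_mem_right {i k : Fin d} (hi : i ∈ G.right C) (hk : k ∉ G.right C) :
    A i k = 0 := by
  by_contra hne
  rcases hA.ne_zero_iff.1 hne with rfl | he
  · exact hk hi
  · exact hk (G.mem_right_of_edge hi he)

theorem isUnit_det : IsUnit A.det :=
  isUnit_det_of_unitUpper hA.diag fun _ _ h => hA.eq_zero_of_lt h

theorem isUnit_det_blk (a : Finset (Fin d)) : IsUnit (blk A a a).det :=
  isUnit_det_of_unitUpper (X := blk A a a) (fun i => hA.diag i)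
    fun _ _ h => hA.eq_zero_of_lt h

theorem posDef_diagonal : (diagonal δ).PosDef := Matrix.posDef_diagonal_iff.2 hA.pos

theorem mul_cov_mul_transpose : A * cov A δ * Aᵀ = diagonal δ := by
  have h := hA.isUnit_det
  rw [cov, Matrix.transpose_nonsing_inv, Matrix.mul_assoc, Matrix.mul_assoc,
    Matrix.nonsing_inv_mul _ (by rwa [Matrix.det_transpose]), Matrix.mul_one,
    Matrix.mul_nonsing_inv_cancel_left _ _ h]

theorem posDef_cov : (cov A δ).PosDef := by
  have h := hA.posDef_diagonal.mul_mul_conjTranspose_same (B := A⁻¹) ?_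
  · simpa [cov, Matrix.conjTranspose_eq_transpose_of_trivial] using h
  · refine Matrix.vecMul_injective_of_isUnit ?_
    rw [Matrix.isUnit_iff_isUnit_det]
    exact Matrix.isUnit_nonsing_inv_det A hA.isUnit_det

theorem isUnit_det_blk_cov (a : Finset (Fin d)) : IsUnit (blk (cov A δ) a a).det :=
  (Matrix.isUnit_iff_isUnit_det _).1
    (hA.posDef_cov.submatrix (e := fun i : a => (i : Fin d)) Subtype.val_injective).isUnit

/-- A row of `A` in `R` only involves columns in `R`. -/
theorem sum_right_mul {i : Fin d} (hi : i ∈ G.right C) (f : Fin d → ℝ) :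
    ∑ k : G.right C, A i k * f k = ∑ k, A i k * f k := by
  rw [Finset.sum_coe_sort (G.right C) (fun k => A i k * f k)]
  refine Finset.sum_subset (Finset.subset_univ _) fun k _ hk => ?_
  rw [hA.eq_zero_of_mem_right hi hk, zero_mul]

/-- Since `R` contains its parents, `Y_R` satisfies a triangular system of its own: `A_RR Σ_RR A_RRᵀ
= Δ_RR`, which is then inverted. -/
theorem inv_blk_cov_right :
    (blk (cov A δ) (G.right C) (G.right C))⁻¹
      = (blk A (G.right C) (G.right C))ᵀ * diagonal (fun r : G.right C => (δ r)⁻¹)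
        * blk A (G.right C) (G.right C) := by
  set R := G.right C
  have h1 : blk A R R * blk (cov A δ) R R * (blk A R R)ᵀ = diagonal (fun r : R => δ r) := by
    ext i k
    have h2 : (A * cov A δ * Aᵀ) i k = (diagonal (fun r : R => δ r)) i k := by
      rw [hA.mul_cov_mul_transpose]
      by_cases hik : i = k
      · rw [hik, Matrix.diagonal_apply_eq, Matrix.diagonal_apply_eq]
      · rw [Matrix.diagonal_apply_ne _ hik,
          Matrix.diagonal_apply_ne _ fun h => hik (Subtype.ext h)]
    rw [← h2]
    have h5 : ∀ x : R, (blk A R R * blk (cov A δ) R R) i x = (A * cov A δ) i x := fun x => by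
      rw [Matrix.mul_apply, Matrix.mul_apply]
      exact hA.sum_right_mul i.2 fun j => cov A δ j x
    rw [Matrix.mul_apply, Matrix.mul_apply]
    simp only [h5, Matrix.transpose_apply, blk_apply, mul_comm _ (A (k : Fin d) _)]
    exact hA.sum_right_mul k.2 fun x => (A * cov A δ) i x
  have hu := hA.isUnit_det_blk R
  have hu' : IsUnit ((blk A R R)ᵀ).det := by rwa [Matrix.det_transpose]
  have h3 : blk (cov A δ) R R
      = (blk A R R)⁻¹ * diagonal (fun r : R => δ r) * ((blk A R R)ᵀ)⁻¹ := by
    rw [← h1, Matrix.mul_assoc (blk A R R), Matrix.nonsing_inv_mul_cancel_left _ _ hu,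
      Matrix.mul_nonsing_inv_cancel_right _ _ hu']
  refine Matrix.inv_eq_left_inv ?_
  rw [h3]
  have h4 : diagonal (fun r : R => (δ r)⁻¹) * diagonal (fun r : R => δ r) = 1 := by
    rw [Matrix.diagonal_mul_diagonal, ← Matrix.diagonal_one]
    congr 1
    ext r
    exact inv_mul_cancel₀ (hA.pos r).ne'
  simp only [Matrix.mul_assoc]
  rw [Matrix.mul_nonsing_inv_cancel_left _ _ hu, ← Matrix.mul_assoc (diagonal _), h4,
    Matrix.one_mul, Matrix.mul_nonsing_inv _ hu']

end IsTriangularSystem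

variable (C A δ) in
/-- The matrix `A_{R·}ᵀ Δ_RR⁻¹ A_{R·}`, whose `(R, R)` block is the concentration matrix
of `Y_R`. -/
def conc : Matrix (Fin d) (Fin d) ℝ :=
  Matrix.of fun i k => ∑ r ∈ G.right C, A r i * A r k * (δ r)⁻¹

theorem conc_transpose : (G.conc C A δ)ᵀ = G.conc C A δ := by
  ext i k
  simp only [conc, Matrix.transpose_apply, Matrix.of_apply, mul_comm (A _ i)]

variable {G} in
theorem IsTriangularSystem.inv_blk_cov_right_eq (hA : G.IsTriangularSystem A δ) :
    (blk (cov A δ) (G.right C) (G.right C))⁻¹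
      = blk (G.conc C A δ) (G.right C) (G.right C) := by
  rw [hA.inv_blk_cov_right]
  ext i k
  rw [blk_apply, conc, Matrix.of_apply, ← Finset.sum_coe_sort, Matrix.mul_apply]
  refine Finset.sum_congr rfl fun r _ => ?_
  rw [Matrix.mul_diagonal, Matrix.transpose_apply, blk_apply, blk_apply]
  ring

variable {G} in
theorem IsTriangularSystem.conFF_eq (hA : G.IsTriangularSystem A δ) :
    G.conFF C A δ = blk (G.conc C A δ) (G.foster C) (G.foster C) := by
  rw [conFF, hA.inv_blk_cov_right_eq]
  rfl

variable {G} in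
theorem IsTriangularSystem.sigmaQQ_eq (hA : G.IsTriangularSystem A δ) :
    G.sigmaQQ C M A δ = (blk (G.conc C A δ) (G.q C M) (G.q C M))⁻¹ := by
  rw [sigmaQQ, invConFF, hA.conFF_eq]
  exact partialInv_subtype_mem_mem _ (G.q_subset_foster C M)

variable {G} in
theorem IsTriangularSystem.piQV_eq (hA : G.IsTriangularSystem A δ) :
    G.piQV C M A δ = -((blk (G.conc C A δ) (G.q C M) (G.q C M))⁻¹
      * blk (G.conc C A δ) (G.q C M) (G.v C M)) := by
  rw [piQV, invConFF, hA.conFF_eq]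
  exact partialInv_subtype_mem_notMem _ (G.q_subset_foster C M) (G.v_subset_foster C M)
    G.disjoint_q_v

variable {G} in
theorem IsTriangularSystem.sigmaVV_eq (hA : G.IsTriangularSystem A δ) :
    G.sigmaVV C M A δ = blk (G.conc C A δ) (G.v C M) (G.v C M)
      - blk (G.conc C A δ) (G.v C M) (G.q C M) * (blk (G.conc C A δ) (G.q C M) (G.q C M))⁻¹
      * blk (G.conc C A δ) (G.q C M) (G.v C M) := by
  rw [sigmaVV, invConFF, hA.conFF_eq]
  exact partialInv_subtype_notMem_notMem _ (G.q_subset_foster C M) (G.v_subset_foster C M)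
    G.disjoint_q_v

variable {G} in
theorem IsTriangularSystem.posDef_blk_conc (hA : G.IsTriangularSystem A δ)
    {a : Finset (Fin d)} (ha : a ⊆ G.right C) : (blk (G.conc C A δ) a a).PosDef := by
  have h : (blk (G.conc C A δ) (G.right C) (G.right C)).PosDef := by
    rw [← hA.inv_blk_cov_right_eq]
    exact (hA.posDef_cov.submatrix (e := fun i : G.right C => (i : Fin d))
      Subtype.val_injective).inv
  refine h.submatrix (e := incl ha) fun x y hxy => ?_
  exact Subtype.ext (congrArg (fun z : G.right C => (z : Fin d)) hxy)

/-! ### Entries of `inv_p A` -/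

section ParamD

variable {i k : Fin d}

theorem paramD_notMem_notMem (hi : i ∉ G.p C M) (hk : k ∉ G.p C M) :
    G.paramD C M A i k = A i k - ∑ y : G.p C M,
      (∑ x : G.p C M, A i x * (blk A (G.p C M) (G.p C M))⁻¹ x y) * A y k := by
  simp only [paramD, partialInv, assemble, Matrix.of_apply, hi, hk, dif_neg, not_false_eq_true,
    Matrix.sub_apply, Matrix.mul_apply, blk_apply]

theorem paramD_notMem_mem (hi : i ∉ G.p C M) (hk : k ∈ G.p C M) :
    G.paramD C M A i k =
      ∑ x : G.p C M, A i x * (blk A (G.p C M) (G.p C M))⁻¹ x ⟨k, hk⟩ := by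
  simp only [paramD, partialInv, assemble, Matrix.of_apply, hi, hk, dif_neg, dif_pos,
    not_false_eq_true, Matrix.mul_apply, blk_apply]

end ParamD

end ParentGraph

/-- The covariance matrix of the residuals of all variables after regression on `Y_C`. -/
def residualCov {d : ℕ} (S : Matrix (Fin d) (Fin d) ℝ) (C : Finset (Fin d)) :
    Matrix (Fin d) (Fin d) ℝ :=
  S - S.submatrix id (fun c : C => (c : Fin d)) * (blk S C C)⁻¹
    * S.submatrix (fun c : C => (c : Fin d)) id

theorem condCov_eq {d : ℕ} (S : Matrix (Fin d) (Fin d) ℝ) (u v C : Finset (Fin d)) :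
    condCov S u v C = fromBlocks (blk (residualCov S C) u u) (blk (residualCov S C) u v)
      (blk (residualCov S C) v u) (blk (residualCov S C) v v) := by
  ext i k
  rcases i with i | i <;> rcases k with k | k <;> rfl

theorem residualCov_transpose {d : ℕ} {S : Matrix (Fin d) (Fin d) ℝ} (hS : Sᵀ = S)
    (C : Finset (Fin d)) : (residualCov S C)ᵀ = residualCov S C := by
  have h1 : (blk S C C)ᵀ = blk S C C := by
    conv_rhs => rw [← hS]
    rfl
  have h2 : (S.submatrix id (fun c : C => (c : Fin d)))ᵀ
      = S.submatrix (fun c : C => (c : Fin d)) id := by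
    conv_rhs => rw [← hS]
    rfl
  have h3 : (S.submatrix (fun c : C => (c : Fin d)) id)ᵀ
      = S.submatrix id (fun c : C => (c : Fin d)) := by
    rw [← h2, Matrix.transpose_transpose]
  rw [residualCov, Matrix.transpose_sub, Matrix.transpose_mul, Matrix.transpose_mul,
    Matrix.transpose_nonsing_inv, h1, h2, h3, hS, Matrix.mul_assoc]

theorem residualCov_eq_zero {d : ℕ} {S : Matrix (Fin d) (Fin d) ℝ} {C : Finset (Fin d)}
    (hS : IsUnit (blk S C C).det) {c : Fin d} (hc : c ∈ C) (k : Fin d) :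
    residualCov S C c k = 0 := by
  have h : (blk S C C * (blk S C C)⁻¹ * S.submatrix (fun c : C => (c : Fin d)) id) ⟨c, hc⟩ k
      = S c k := by
    rw [Matrix.mul_nonsing_inv _ hS, Matrix.one_mul]
    rfl
  rw [residualCov, Matrix.sub_apply, sub_eq_zero, ← h]
  rfl

theorem blk_transpose_of_symm {n : Type*} {S : Matrix n n ℝ} (hS : Sᵀ = S) (a b : Finset n) :
    (blk S a b)ᵀ = blk S b a := by
  conv_rhs => rw [← hS]
  rfl

/-! ### Elimination of `Y_p` and residuals given `Y_C` -/

namespace ParentGraph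

variable {d : ℕ} (G : ParentGraph d) {C M : Finset (Fin d)}
  {A : Matrix (Fin d) (Fin d) ℝ} {δ : Fin d → ℝ}

variable (C M) in
theorem sum_eq_sum_parts (f : Fin d → ℝ) :
    ∑ k, f k = (∑ x : G.u C M, f x) + (∑ x : G.v C M, f x) + (∑ x : G.q C M, f x)
      + (∑ x : G.p C M, f x) + ∑ x : C, f x := by
  simp only [Finset.sum_coe_sort]
  have h1 : ∑ k ∈ G.right C, f k + ∑ k ∈ G.outsiders C, f k = ∑ k, f k :=
    Finset.sum_add_sum_compl _ _
  have h2 : ∑ k ∈ G.right C, f k = ∑ k ∈ C, f k + ∑ k ∈ G.foster C, f k :=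
    Finset.sum_union (Finset.disjoint_left.2 fun x hx hx' => G.notMem_of_mem_foster hx' hx)
  have h3 : ∑ k ∈ G.q C M, f k + ∑ k ∈ G.v C M, f k = ∑ k ∈ G.foster C, f k :=
    Finset.sum_sdiff (G.v_subset_foster C M)
  have h4 : ∑ k ∈ G.p C M, f k + ∑ k ∈ G.u C M, f k = ∑ k ∈ G.outsiders C, f k :=
    Finset.sum_sdiff Finset.sdiff_subset
  linarith

namespace IsTriangularSystem

variable {G} (hA : G.IsTriangularSystem A δ)

include hA

/-- Eliminating the nodes of `p` from the equations of a triangular system. -/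
theorem sub_sum_paramD_mul {i : Fin d} (hi : i ∉ G.p C M) (k : Fin d) :
    A i k - ∑ y : G.p C M, G.paramD C M A i y * A y k
      = if k ∈ G.p C M then 0 else G.paramD C M A i k := by
  have h1 : ∀ y : G.p C M, G.paramD C M A i y
      = ∑ x : G.p C M, A i x * (blk A (G.p C M) (G.p C M))⁻¹ x y := fun y =>
    G.paramD_notMem_mem hi y.2
  split_ifs with hk
  -- The row `A_ip` is treated as a one-row matrix so that `A_pp⁻¹ A_pp` cancels.
  · have h2 : (Matrix.of (fun (_ : Unit) (x : G.p C M) => A i x)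
        * (blk A (G.p C M) (G.p C M))⁻¹ * blk A (G.p C M) (G.p C M)) () ⟨k, hk⟩ = A i k := by
      rw [Matrix.nonsing_inv_mul_cancel_right _ _ (hA.isUnit_det_blk _)]
      rfl
    rw [sub_eq_zero, ← h2]
    simp only [h1, Matrix.mul_apply, Matrix.of_apply, blk_apply]
  · simp only [h1, G.paramD_notMem_notMem hi hk]

/-- Subtracting multiples of the `p`-equations removes the columns in `p`, and `g` kills those in
`C`; what remains is `D` on `u`, `v`, `q`. It is used with `g` a column of the residual covariance
and again with `g` a row of `A` times it. -/
theorem sum_paramD_mul {i : Fin d} (hi : i ∉ G.p C M) {g : Fin d → ℝ} (hg : ∀ c ∈ C, g c = 0) :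
    (∑ x : G.u C M, G.paramD C M A i x * g x) + (∑ x : G.v C M, G.paramD C M A i x * g x)
        + (∑ x : G.q C M, G.paramD C M A i x * g x)
      = (A *ᵥ g) i - ∑ y : G.p C M, G.paramD C M A i y * (A *ᵥ g) y := by
  have h1 : (A *ᵥ g) i - ∑ y : G.p C M, G.paramD C M A i y * (A *ᵥ g) y
      = ∑ k, (if k ∈ G.p C M then 0 else G.paramD C M A i k) * g k := by
    simp only [← hA.sub_sum_paramD_mul hi, sub_mul, Finset.sum_sub_distrib, Matrix.mulVec,
      dotProduct, Finset.mul_sum, Finset.sum_mul]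
    rw [Finset.sum_comm]
    simp only [mul_assoc]
  rw [h1, G.sum_eq_sum_parts C M]
  have hu : ∀ x : G.u C M, (x : Fin d) ∉ G.p C M := fun x => G.notMem_p_of_mem_u x.2
  have hv : ∀ x : G.v C M, (x : Fin d) ∉ G.p C M := fun x =>
    G.notMem_p_of_mem_right (G.mem_right_of_mem_v x.2)
  have hq : ∀ x : G.q C M, (x : Fin d) ∉ G.p C M := fun x =>
    G.notMem_p_of_mem_right (G.mem_right_of_mem_q x.2)
  have hC : ∀ x : C, g x = 0 := fun x => hg x x.2
  simp [hu, hv, hq, hC]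

theorem inv_eq_zero_of_mem_right {i k : Fin d} (hi : i ∈ G.right C) (hk : k ∉ G.right C) :
    A⁻¹ i k = 0 := by
  by_contra hne
  have h := reflTransGen_of_inv_ne_zero (r := fun x y => A x y ≠ 0) (fun _ _ h => h) hne
  refine hk ?_
  clear hne hk
  induction h with
  | refl => exact hi
  | tail _ hxy ih =>
    by_contra hc
    exact hxy (hA.eq_zero_of_mem_right ih hc)

theorem cov_transpose : (cov A δ)ᵀ = cov A δ := by
  have h := hA.posDef_cov.isHermitian.eq
  rwa [Matrix.conjTranspose_eq_transpose_of_trivial] at h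

/-- `AΣ = Δ A⁻ᵀ` is the covariance of the errors with `Y`, and `Y_R` involves no error of an
outsider. -/
theorem mul_cov_eq_zero {i k : Fin d} (hi : i ∈ G.outsiders C) (hk : k ∈ G.right C) :
    (A * cov A δ) i k = 0 := by
  rw [cov, Matrix.mul_assoc, Matrix.mul_nonsing_inv_cancel_left _ _ hA.isUnit_det,
    Matrix.diagonal_mul, Matrix.transpose_apply,
    hA.inv_eq_zero_of_mem_right hk (G.mem_outsiders_iff_notMem.1 hi), mul_zero]

/-- The correction for regression on `Y_C` has the factor `cov(ε_i, Y_C)`, which is zero for an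
outsider. -/
theorem mul_residualCov {i : Fin d} (hi : i ∈ G.outsiders C) (k : Fin d) :
    (A * residualCov (cov A δ) C) i k = (A * cov A δ) i k := by
  have h : ∀ c : C, (A * (cov A δ).submatrix id (fun c : C => (c : Fin d))) i c = 0 := fun c =>
    hA.mul_cov_eq_zero hi (G.mem_right_iff.2 (Or.inl c.2))
  rw [residualCov, Matrix.mul_sub, Matrix.sub_apply, ← Matrix.mul_assoc, ← Matrix.mul_assoc,
    Matrix.mul_assoc (A * _), Matrix.mul_apply (M := A * (cov A δ).submatrix _ _)]
  simp [h]

theorem mul_residualCov_mul_transpose {i k : Fin d} (hi : i ∈ G.outsiders C) :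
    (A * residualCov (cov A δ) C * Aᵀ) i k = diagonal δ i k := by
  rw [← hA.mul_cov_mul_transpose, Matrix.mul_apply, Matrix.mul_apply]
  simp only [hA.mul_residualCov hi]

/-- The `(F, F)` block of `Σ_RR⁻¹` inverts `Σ_{FF|C}`: in `Σ_RR⁻¹ Σ_RR = 1` the regression
correction contributes only entries in columns of `C`, zero for rows in `F`, and residual rows of
`C` vanish. -/
theorem sum_conc_mul_residualCov {i k : Fin d} (hi : i ∈ G.foster C) (hk : k ∈ G.foster C) :
    (∑ x : G.q C M, G.conc C A δ i x * residualCov (cov A δ) C x k)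
        + (∑ x : G.v C M, G.conc C A δ i x * residualCov (cov A δ) C x k)
      = (1 : Matrix (Fin d) (Fin d) ℝ) i k := by
  set R := G.right C
  have hiR : i ∈ R := G.foster_subset_right C hi
  have hkR : k ∈ R := G.foster_subset_right C hk
  have h1 : ∀ j ∈ R, ∑ x ∈ R, G.conc C A δ i x * cov A δ x j
      = (1 : Matrix (Fin d) (Fin d) ℝ) i j := by
    intro j hj
    have h2 : (blk (G.conc C A δ) R R * blk (cov A δ) R R) ⟨i, hiR⟩ ⟨j, hj⟩
        = (1 : Matrix R R ℝ) ⟨i, hiR⟩ ⟨j, hj⟩ := by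
      have hinv : (blk (cov A δ) R R)⁻¹ = blk (G.conc C A δ) R R := hA.inv_blk_cov_right_eq
      rw [← hinv, Matrix.nonsing_inv_mul _ (hA.isUnit_det_blk_cov _)]
    rw [Matrix.mul_apply] at h2
    rw [← Finset.sum_coe_sort]
    refine h2.trans ?_
    by_cases hij : i = j
    · subst hij
      rw [Matrix.one_apply_eq, Matrix.one_apply_eq]
    · rw [Matrix.one_apply_ne hij, Matrix.one_apply_ne fun h => hij (congrArg Subtype.val h)]
  have h3 : ∑ x ∈ R, G.conc C A δ i x * residualCov (cov A δ) C x k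
      = (1 : Matrix (Fin d) (Fin d) ℝ) i k := by
    have h4 : ∀ x, residualCov (cov A δ) C x k = cov A δ x k - ∑ c : C, cov A δ x c
        * ((blk (cov A δ) C C)⁻¹ * (cov A δ).submatrix (fun c : C => (c : Fin d)) id) c k := by
      intro x
      rw [residualCov, Matrix.mul_assoc, Matrix.sub_apply, Matrix.mul_apply]
      rfl
    simp only [h4, mul_sub, Finset.sum_sub_distrib, Finset.mul_sum]
    rw [h1 k hkR, Finset.sum_comm]
    simp only [← mul_assoc, ← Finset.sum_mul]
    rw [sub_eq_self]
    refine Finset.sum_eq_zero fun c _ => ?_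
    rw [h1 c (G.mem_right_iff.2 (Or.inl c.2)), Matrix.one_apply_ne, zero_mul]
    rintro rfl
    exact G.notMem_of_mem_foster hi c.2
  have h5 : ∑ x ∈ R, G.conc C A δ i x * residualCov (cov A δ) C x k
      = ∑ x ∈ C, G.conc C A δ i x * residualCov (cov A δ) C x k
        + ∑ x ∈ G.foster C, G.conc C A δ i x * residualCov (cov A δ) C x k :=
    Finset.sum_union (Finset.disjoint_left.2 fun x hx hx' => G.notMem_of_mem_foster hx' hx)
  have h6 : ∑ x ∈ C, G.conc C A δ i x * residualCov (cov A δ) C x k = 0 :=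
    Finset.sum_eq_zero fun c hc => by
      rw [residualCov_eq_zero (hA.isUnit_det_blk_cov C) hc, mul_zero]
  have h7 := Finset.sum_sdiff (f := fun x => G.conc C A δ i x * residualCov (cov A δ) C x k)
    (G.v_subset_foster C M)
  rw [h6, zero_add] at h5
  rw [← h3, h5, ← h7, ← Finset.sum_coe_sort (G.foster C \ G.v C M),
    ← Finset.sum_coe_sort (G.v C M)]
  rfl

end IsTriangularSystem

end ParentGraph

/-! ### Block elimination in a concentration matrix -/

section Elimination

variable {q v : Type*} [Fintype q] [DecidableEq q] [Fintype v]
  {Kqq Sqq : Matrix q q ℝ} {Kqv Sqv : Matrix q v ℝ} {Kvq Svq : Matrix v q ℝ}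
  {Kvv Svv : Matrix v v ℝ} (hK : IsUnit Kqq.det)

include hK

theorem eq_regression_mul (h : Kqq * Sqv + Kqv * Svv = 0) :
    Sqv = -(Kqq⁻¹ * Kqv) * Svv := by
  rw [Matrix.neg_mul, Matrix.mul_assoc, eq_neg_of_add_eq_zero_right h, Matrix.mul_neg,
    Matrix.nonsing_inv_mul_cancel_left _ _ hK, neg_neg]

theorem eq_inv_add_regression_mul (h : Kqq * Sqq + Kqv * Svq = 1) :
    Sqq = Kqq⁻¹ + -(Kqq⁻¹ * Kqv) * Svq := by
  rw [Matrix.neg_mul, Matrix.mul_assoc, eq_sub_of_add_eq' h, Matrix.mul_sub, Matrix.mul_one,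
    Matrix.nonsing_inv_mul_cancel_left _ _ hK]
  abel

theorem schur_mul_eq_one [DecidableEq v] (h : Kqq * Sqv + Kqv * Svv = 0)
    (h' : Kvq * Sqv + Kvv * Svv = 1) :
    (Kvv - Kvq * Kqq⁻¹ * Kqv) * Svv = 1 := by
  rw [← h', eq_regression_mul hK h]
  simp only [Matrix.sub_mul, Matrix.neg_mul, Matrix.mul_neg, Matrix.mul_assoc]
  abel

end Elimination

/-- The residual covariance matrix of the block-triangular system obtained after removing the
regression of the `q`-variables on the `v`-variables. -/
theorem fromBlocks_mul_mul_transpose_eq {u v q p : Type*} [Fintype u] [Fintype v] [Fintype q]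
    [Fintype p] [DecidableEq v]
    {Duu Suu Xu Δu : Matrix u u ℝ} {Duv Suv : Matrix u v ℝ} {Duq Suq : Matrix u q ℝ}
    {Dup : Matrix u p ℝ} {Xp : Matrix p u ℝ} {Δp : Matrix p p ℝ} {L Svv : Matrix v v ℝ}
    {T Sqq : Matrix q q ℝ} {Sqv B : Matrix q v ℝ}
    (hv : Duu * Suv + Duv * Svv + Duq * Sqv = 0)
    (hq : Duu * Suq + Duv * Sqvᵀ + Duq * Sqq = 0)
    (hu : Duu * Suu + Duv * Suvᵀ + Duq * Suqᵀ = Xu - Dup * Xp)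
    (hXu : Xu * Duuᵀ = Δu) (hXp : Xp * Duuᵀ = -(Δp * Dupᵀ))
    (hsymm : Svvᵀ = Svv) (hTsymm : Tᵀ = T) (hLsymm : Lᵀ = L)
    (hB : Sqv = B * Svv) (hT : Sqq = T + B * Sqvᵀ) (hSqq : Sqqᵀ = Sqq) (hL : L * Svv = 1) :
    fromBlocks Duu (Duv + Duq * B) 0 L * fromBlocks Suu Suv Suvᵀ Svv
        * (fromBlocks Duu (Duv + Duq * B) 0 L)ᵀ
      = fromBlocks ((Δu + Dup * Δp * Dupᵀ) + Duq * T * Duqᵀ) 0 0 L := by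
  -- With `Y_q` replaced by its regression `B Y_v`, the residual of `u` remains uncorrelated with
  -- `Y_v`.
  have h12 : Duu * Suv + (Duv + Duq * B) * Svv = 0 := by
    rw [← hv, hB, Matrix.add_mul, Matrix.mul_assoc, add_assoc]
  have h21 : Suvᵀ * Duuᵀ + Svv * (Duv + Duq * B)ᵀ = 0 := by
    have := congrArg Matrix.transpose h12
    rwa [Matrix.transpose_add, Matrix.transpose_mul, Matrix.transpose_mul, hsymm,
      Matrix.transpose_zero] at this
  -- `Suqᵀ - B Suvᵀ` is the covariance of `Y_q - B Y_v` with `Y_u`. It is computed from the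
  -- equations `hv` and `hq`, with `T` the covariance of that regression residual.
  have hqu : (Suqᵀ - B * Suvᵀ) * Duuᵀ = -(T * Duqᵀ) := by
    have hT' : Sqq = T + Sqv * Bᵀ := by
      have := congrArg Matrix.transpose hT
      rwa [hSqq, Matrix.transpose_add, Matrix.transpose_mul, Matrix.transpose_transpose,
        hTsymm] at this
    have hB' : Sqvᵀ = Svv * Bᵀ := by rw [hB, Matrix.transpose_mul, hsymm]
    have h1 : Duu * (Suq - Suv * Bᵀ) = -(Duq * T) := by
      have e1 : Duu * Suq = -(Duv * Sqvᵀ + Duq * Sqq) := by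
        rw [add_assoc] at hq; exact eq_neg_of_add_eq_zero_left hq
      have e2 : Duu * Suv = -(Duv * Svv + Duq * Sqv) := by
        rw [add_assoc] at hv; exact eq_neg_of_add_eq_zero_left hv
      rw [Matrix.mul_sub, ← Matrix.mul_assoc, e1, e2, hB', hT', Matrix.neg_mul, Matrix.add_mul,
        Matrix.mul_add, Matrix.mul_assoc, Matrix.mul_assoc]
      abel
    have := congrArg Matrix.transpose h1
    simpa [Matrix.transpose_mul, hTsymm] using this
  have h11 : (Duu * Suu + (Duv + Duq * B) * Suvᵀ) * Duuᵀ
      = (Δu + Dup * Δp * Dupᵀ) + Duq * T * Duqᵀ := by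
    have e : Duu * Suu + (Duv + Duq * B) * Suvᵀ
        = Xu - Dup * Xp - Duq * (Suqᵀ - B * Suvᵀ) := by
      -- Matrix form of the decomposition `ε_u - D_up ε_p - D_uq (Y_q - B Y_v)`, paired with `Y_u`.
      rw [← hu, Matrix.add_mul, Matrix.mul_sub, Matrix.mul_assoc]
      abel
    rw [e, Matrix.sub_mul, Matrix.sub_mul, hXu, Matrix.mul_assoc Dup, hXp, Matrix.mul_assoc Duq,
      hqu]
    simp only [Matrix.mul_neg, sub_neg_eq_add, Matrix.mul_assoc]
  rw [Matrix.fromBlocks_transpose, Matrix.fromBlocks_multiply, Matrix.fromBlocks_multiply]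
  simp only [Matrix.zero_mul, zero_add, h12, hL, Matrix.transpose_zero, Matrix.mul_zero,
    add_zero, h11, Matrix.one_mul, hLsymm]
  congr 1
  -- The lower left block is `h21` multiplied by `L`, simplified by `L Svv = 1`.
  have h := congrArg (L * ·) h21
  simpa only [Matrix.mul_add, ← Matrix.mul_assoc, hL, Matrix.one_mul, Matrix.mul_zero] using h

/-! ### The Gaussian summary graph model -/

namespace ParentGraph

variable {d : ℕ} {G : ParentGraph d} {C M : Finset (Fin d)}
  {A : Matrix (Fin d) (Fin d) ℝ} {δ : Fin d → ℝ}

namespace IsTriangularSystem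

variable (hA : G.IsTriangularSystem A δ)

include hA

theorem blk_conc_mul_residualCov {a b : Finset (Fin d)} (ha : a ⊆ G.foster C)
    (hb : b ⊆ G.foster C) :
    blk (G.conc C A δ) a (G.q C M) * blk (residualCov (cov A δ) C) (G.q C M) b
        + blk (G.conc C A δ) a (G.v C M) * blk (residualCov (cov A δ) C) (G.v C M) b
      = blk 1 a b := by
  ext i k
  exact hA.sum_conc_mul_residualCov (ha i.2) (hb k.2)

theorem blk_paramD_mul_residualCov (b : Finset (Fin d)) :
    blk (G.paramD C M A) (G.u C M) (G.u C M) * blk (residualCov (cov A δ) C) (G.u C M) b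
        + blk (G.paramD C M A) (G.u C M) (G.v C M) * blk (residualCov (cov A δ) C) (G.v C M) b
        + blk (G.paramD C M A) (G.u C M) (G.q C M) * blk (residualCov (cov A δ) C) (G.q C M) b
      = blk (A * residualCov (cov A δ) C) (G.u C M) b
        - blk (G.paramD C M A) (G.u C M) (G.p C M)
          * blk (A * residualCov (cov A δ) C) (G.p C M) b := by
  ext i k
  exact hA.sum_paramD_mul (G.notMem_p_of_mem_u i.2) (g := fun j => residualCov (cov A δ) C j k)
    fun c hc => residualCov_eq_zero (hA.isUnit_det_blk_cov C) hc _

theorem blk_mul_residualCov_eq_zero {a b : Finset (Fin d)} (ha : a ⊆ G.outsiders C)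
    (hb : b ⊆ G.right C) : blk (A * residualCov (cov A δ) C) a b = 0 := by
  ext i k
  exact (hA.mul_residualCov (ha i.2) k).trans (hA.mul_cov_eq_zero (ha i.2) (hb k.2))

/-- Elimination applied from the right: a row of `A · residualCov` at an outsider vanishes on `R`,
so only the columns in `u` survive, and multiplication by `Aᵀ` turns that row into a row of `Δ`. -/
theorem mul_residualCov_mul_paramD {i k : Fin d} (hi : i ∈ G.outsiders C) (hk : k ∈ G.u C M) :
    ∑ x : G.u C M, (A * residualCov (cov A δ) C) i x * G.paramD C M A k x
      = diagonal δ i k - ∑ y : G.p C M, diagonal δ i y * G.paramD C M A k y := by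
  have h0 : ∀ j ∈ G.right C, (A * residualCov (cov A δ) C) i j = 0 := fun j hj =>
    (hA.mul_residualCov hi j).trans (hA.mul_cov_eq_zero hi hj)
  have h := hA.sum_paramD_mul (G.notMem_p_of_mem_u hk)
    (g := fun j => (A * residualCov (cov A δ) C) i j)
    fun c hc => h0 c (G.mem_right_iff.2 (Or.inl hc))
  have hv : ∀ x : G.v C M, (A * residualCov (cov A δ) C) i x = 0 := fun x =>
    h0 x (G.mem_right_of_mem_v x.2)
  have hq : ∀ x : G.q C M, (A * residualCov (cov A δ) C) i x = 0 := fun x =>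
    h0 x (G.mem_right_of_mem_q x.2)
  have hm : ∀ j, (A *ᵥ fun j => (A * residualCov (cov A δ) C) i j) j = diagonal δ i j := by
    intro j
    rw [← hA.mul_residualCov_mul_transpose hi, Matrix.mul_apply]
    simp only [Matrix.mulVec, dotProduct, Matrix.transpose_apply, mul_comm (A j _)]
  simp only [hv, hq, hm, mul_zero, Finset.sum_const_zero, add_zero] at h
  simp only [mul_comm _ (G.paramD C M A k _)]
  exact h

theorem isHermitian_sigmaQQ : (G.sigmaQQ C M A δ)ᵀ = G.sigmaQQ C M A δ := by
  rw [hA.sigmaQQ_eq, Matrix.transpose_nonsing_inv, blk_transpose_of_symm G.conc_transpose]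

theorem posDef_sigmaQQ : (G.sigmaQQ C M A δ).PosDef := by
  rw [hA.sigmaQQ_eq]
  exact (hA.posDef_blk_conc fun _ => G.mem_right_of_mem_q).inv

theorem isUnit_det_blk_conc_q : IsUnit (blk (G.conc C A δ) (G.q C M) (G.q C M)).det :=
  (Matrix.isUnit_iff_isUnit_det _).1 (hA.posDef_blk_conc fun _ => G.mem_right_of_mem_q).isUnit

theorem sigmaVV_mul_residualCov :
    G.sigmaVV C M A δ * blk (residualCov (cov A δ) C) (G.v C M) (G.v C M) = 1 := by
  rw [hA.sigmaVV_eq]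
  refine schur_mul_eq_one (Sqv := blk (residualCov (cov A δ) C) (G.q C M) (G.v C M))
    hA.isUnit_det_blk_conc_q ?_ ?_
  · rw [hA.blk_conc_mul_residualCov (G.q_subset_foster C M) (G.v_subset_foster C M)]
    ext i k
    exact Matrix.one_apply_ne (G.ne_of_mem_q_of_mem_v i.2 k.2)
  · rw [hA.blk_conc_mul_residualCov (G.v_subset_foster C M) (G.v_subset_foster C M)]
    exact Matrix.submatrix_one _ Subtype.val_injective

/-- A Schur complement of a positive semidefinite matrix is positive semidefinite, and this one is
invertible because `Σ_{vv|C}` is a right inverse. -/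
theorem posDef_sigmaVV : (G.sigmaVV C M A δ).PosDef := by
  have hunit : IsUnit (G.sigmaVV C M A δ) :=
    IsUnit.of_mul_eq_one _ hA.sigmaVV_mul_residualCov
  refine Matrix.PosSemidef.posDef_iff_isUnit ?_ |>.2 hunit
  have hq : (blk (G.conc C A δ) (G.q C M) (G.q C M)).PosDef :=
    hA.posDef_blk_conc fun _ => G.mem_right_of_mem_q
  let := Matrix.invertibleOfIsUnitDet _ (hA.isUnit_det_blk_conc_q (C := C) (M := M))
  have h := Matrix.PosDef.fromBlocks₁₁ (blk (G.conc C A δ) (G.q C M) (G.v C M))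
    (blk (G.conc C A δ) (G.v C M) (G.v C M)) hq
  rw [Matrix.conjTranspose_eq_transpose_of_trivial, blk_transpose_of_symm G.conc_transpose] at h
  rw [hA.sigmaVV_eq, ← h]
  have hR : (blk (G.conc C A δ) (G.right C) (G.right C)).PosSemidef :=
    (hA.posDef_blk_conc subset_rfl).posSemidef
  have h2 := hR.submatrix (Sum.elim (incl fun _ => G.mem_right_of_mem_q)
    (incl fun _ => G.mem_right_of_mem_v) : G.q C M ⊕ G.v C M → G.right C)
  refine (congrArg Matrix.PosSemidef ?_).mpr h2
  ext i k
  rcases i with i | i <;> rcases k with k | k <;> rfl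

theorem posDef_paramWuu : (G.paramWuu C M A δ).PosDef := by
  have h1 : (blk (diagonal δ) (G.u C M) (G.u C M)).PosDef :=
    hA.posDef_diagonal.submatrix (e := fun i : G.u C M => (i : Fin d)) Subtype.val_injective
  have h2 : (blk (diagonal δ) (G.p C M) (G.p C M)).PosSemidef :=
    hA.posDef_diagonal.posSemidef.submatrix _
  have h3 := h2.mul_mul_conjTranspose_same (blk (G.paramD C M A) (G.u C M) (G.p C M))
  have h4 := (hA.posDef_sigmaQQ (C := C) (M := M)).posSemidef.mul_mul_conjTranspose_same
    (blk (G.paramD C M A) (G.u C M) (G.q C M))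
  rw [Matrix.conjTranspose_eq_transpose_of_trivial] at h3 h4
  exact (h1.add_posSemidef h3).add_posSemidef h4

/-- Outside `p`, the matrix `inv_p A` is unit upper-triangular. -/
theorem paramD_of_le {i k : Fin d} (hi : i ∉ G.p C M) (hk : k ∉ G.p C M) (hki : k ≤ i) :
    G.paramD C M A i k = A i k := by
  rw [G.paramD_notMem_notMem hi hk, sub_eq_self]
  refine Finset.sum_eq_zero fun y hy => ?_
  rw [Finset.sum_mul]
  refine Finset.sum_eq_zero fun x _ => ?_
  -- A non-zero summand gives `i ≤ x ≤ y ≤ k ≤ i`, forcing `i = x ∈ p`.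
  by_contra hne
  rw [← Ne, mul_ne_zero_iff, mul_ne_zero_iff] at hne
  have hle : ∀ {a b : Fin d}, A a b ≠ 0 → a ≤ b := fun h =>
    not_lt.1 fun hlt => h (hA.eq_zero_of_lt hlt)
  have h1 := hle hne.1.1
  have h2 := hle hne.2
  have h3 : (x : Fin d) ≤ y := by
    have h := reflTransGen_of_inv_ne_zero (r := fun x y : G.p C M => x ≤ y)
      (fun a b hab => hle hab) hne.1.2
    clear hne h1 h2 hy
    induction h with
    | refl => exact le_rfl
    | tail _ hbc ih => exact ih.trans hbc
  have h4 : (x : Fin d) = i := le_antisymm (h3.trans (h2.trans hki)) h1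
  exact hi (h4 ▸ x.2)

theorem isGaussianSummaryModel :
    IsGaussianSummaryModel (condCov (cov A δ) (G.u C M) (G.v C M) C)
      (G.paramHuu C M A) (G.paramHuv C M A δ) (G.sigmaVV C M A δ) (G.paramWuu C M A δ) where
  diag i := (hA.paramD_of_le (G.notMem_p_of_mem_u i.2) (G.notMem_p_of_mem_u i.2) le_rfl).trans
    (hA.diag i)
  upper i k hik := (hA.paramD_of_le (G.notMem_p_of_mem_u i.2) (G.notMem_p_of_mem_u k.2)
    hik.le).trans (hA.eq_zero_of_lt hik)
  posDef_W := hA.posDef_paramWuu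
  posDef_K := hA.posDef_sigmaVV
  concentration := by
    rw [condCov_eq, Matrix.toBlocks_fromBlocks₂₂]
    exact (Matrix.inv_eq_left_inv hA.sigmaVV_mul_residualCov).symm
  residual := by
    have hsymm := residualCov_transpose hA.cov_transpose C
    have hO : G.u C M ⊆ G.outsiders C := fun _ => G.mem_outsiders_of_mem_u
    have hp : G.p C M ⊆ G.outsiders C := fun _ => G.mem_outsiders_of_mem_p
    have hqR : G.q C M ⊆ G.right C := fun _ => G.mem_right_of_mem_q
    have hvR : G.v C M ⊆ G.right C := fun _ => G.mem_right_of_mem_v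
    rw [condCov_eq, ← blk_transpose_of_symm hsymm (G.u C M) (G.v C M)]
    -- `Xu` and `Xp` are the covariances of `ε_u` and `ε_p` with the residual of `Y_u` given `Y_C`.
    refine fromBlocks_mul_mul_transpose_eq
      (Xu := blk (A * residualCov (cov A δ) C) (G.u C M) (G.u C M))
      (Xp := blk (A * residualCov (cov A δ) C) (G.p C M) (G.u C M))
      (Suq := blk (residualCov (cov A δ) C) (G.u C M) (G.q C M))
      (Sqv := blk (residualCov (cov A δ) C) (G.q C M) (G.v C M))
      (Sqq := blk (residualCov (cov A δ) C) (G.q C M) (G.q C M))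
      ?_ ?_ ?_ ?_ ?_ (blk_transpose_of_symm hsymm _ _) hA.isHermitian_sigmaQQ ?_ ?_ ?_
      (blk_transpose_of_symm hsymm _ _) hA.sigmaVV_mul_residualCov
    · refine (hA.blk_paramD_mul_residualCov _).trans ?_
      rw [hA.blk_mul_residualCov_eq_zero hO hvR, hA.blk_mul_residualCov_eq_zero hp hvR]
      simp
    · rw [blk_transpose_of_symm hsymm]
      refine (hA.blk_paramD_mul_residualCov _).trans ?_
      rw [hA.blk_mul_residualCov_eq_zero hO hqR, hA.blk_mul_residualCov_eq_zero hp hqR]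
      simp
    · rw [blk_transpose_of_symm hsymm, blk_transpose_of_symm hsymm]
      exact hA.blk_paramD_mul_residualCov _
    · ext i k
      refine (hA.mul_residualCov_mul_paramD (hO i.2) k.2).trans ?_
      rw [blk_apply, sub_eq_self]
      refine Finset.sum_eq_zero fun y _ => ?_
      rw [Matrix.diagonal_apply_ne, zero_mul]
      exact fun h => G.notMem_p_of_mem_u i.2 (h ▸ y.2)
    · ext i k
      refine (hA.mul_residualCov_mul_paramD (hp i.2) k.2).trans ?_
      have hik : (i : Fin d) ≠ k := fun h => G.notMem_p_of_mem_u k.2 (h ▸ i.2)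
      rw [Matrix.diagonal_apply_ne _ hik, zero_sub]
      rfl
    · have h := (hA.posDef_sigmaVV (C := C) (M := M)).isHermitian.eq
      rwa [Matrix.conjTranspose_eq_transpose_of_trivial] at h
    · rw [hA.piQV_eq]
      refine eq_regression_mul hA.isUnit_det_blk_conc_q ?_
      rw [hA.blk_conc_mul_residualCov (G.q_subset_foster C M) (G.v_subset_foster C M)]
      ext i k
      exact Matrix.one_apply_ne (G.ne_of_mem_q_of_mem_v i.2 k.2)
    · rw [hA.piQV_eq, hA.sigmaQQ_eq, blk_transpose_of_symm hsymm]
      refine eq_inv_add_regression_mul hA.isUnit_det_blk_conc_q ?_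
      rw [hA.blk_conc_mul_residualCov (G.q_subset_foster C M) (G.q_subset_foster C M)]
      exact Matrix.submatrix_one _ Subtype.val_injective

end IsTriangularSystem

end ParentGraph

/-! ### Products of non-negative matrices -/

section Nonneg

variable {l m n : Type*} [Fintype m]

theorem matrix_mul_nonneg {X : Matrix l m ℝ} {Y : Matrix m n ℝ} (hX : ∀ i j, 0 ≤ X i j)
    (hY : ∀ i j, 0 ≤ Y i j) (i : l) (k : n) : 0 ≤ (X * Y) i k :=
  Finset.sum_nonneg fun _ _ => mul_nonneg (hX _ _) (hY _ _)

theorem matrix_mul_pos {X : Matrix l m ℝ} {Y : Matrix m n ℝ} (hX : ∀ i j, 0 ≤ X i j)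
    (hY : ∀ i j, 0 ≤ Y i j) {i : l} {j : m} {k : n} (h : 0 < X i j) (h' : 0 < Y j k) :
    0 < (X * Y) i k :=
  Finset.sum_pos' (fun _ _ => mul_nonneg (hX _ _) (hY _ _)) ⟨j, Finset.mem_univ j, mul_pos h h'⟩

theorem exists_pos_of_matrix_mul_pos {X : Matrix l m ℝ} {Y : Matrix m n ℝ}
    (hX : ∀ i j, 0 ≤ X i j) (hY : ∀ i j, 0 ≤ Y i j) {i : l} {k : n} (h : 0 < (X * Y) i k) :
    ∃ j, 0 < X i j ∧ 0 < Y j k := by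
  obtain ⟨j, -, hj⟩ := Finset.exists_ne_zero_of_sum_ne_zero h.ne'
  rw [mul_ne_zero_iff] at hj
  exact ⟨j, (hX _ _).lt_of_ne' hj.1, (hY _ _).lt_of_ne' hj.2⟩

theorem matrix_pow_nonneg [DecidableEq m] {X : Matrix m m ℝ} (hX : ∀ i j, 0 ≤ X i j) (t : ℕ)
    (i j : m) : 0 ≤ (X ^ t) i j := by
  induction t generalizing i j with
  | zero => rw [pow_zero, Matrix.one_apply]; split_ifs <;> norm_num
  | succ t ih => rw [pow_succ]; exact matrix_mul_nonneg ih hX i j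

theorem exists_matrix_pow_pos [DecidableEq m] {X : Matrix m m ℝ} (hX : ∀ i j, 0 ≤ X i j)
    {i j : m} (h : Relation.ReflTransGen (fun i j => 0 < X i j) i j) :
    ∃ t : ℕ, 0 < (X ^ t) i j := by
  induction h with
  | refl => exact ⟨0, by simp⟩
  | tail _ hbc ih =>
    obtain ⟨t, ht⟩ := ih
    refine ⟨t + 1, ?_⟩
    rw [pow_succ]
    exact matrix_mul_pos (matrix_pow_nonneg hX t) hX ht hbc

end Nonneg

/-! ### The resolvent of a Gram matrix -/

section Resolvent

variable {q z m n : Type*} [Fintype q] [DecidableEq q] [Fintype z] (E : Matrix z q ℝ)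

/-- `(1 + s EᵀE)⁻¹`. -/
def resolvent (s : ℝ) : Matrix q q ℝ := (1 + s • (Eᵀ * E))⁻¹

theorem isUnit_det_one_add_smul {s : ℝ} (hs : 0 ≤ s) : IsUnit (1 + s • (Eᵀ * E)).det := by
  have h := Matrix.posSemidef_conjTranspose_mul_self E
  rw [Matrix.conjTranspose_eq_transpose_of_trivial] at h
  exact (Matrix.isUnit_iff_isUnit_det _).1
    (Matrix.PosDef.one.add_posSemidef (h.smul hs)).isUnit

/-- One step of the Neumann series; peeling off one power at a time avoids convergence and any
smallness condition on `s`. -/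
theorem resolvent_eq {s : ℝ} (hs : 0 ≤ s) :
    resolvent E s = 1 - s • (Eᵀ * E * resolvent E s) := by
  have h := Matrix.mul_nonsing_inv _ (isUnit_det_one_add_smul E hs)
  rw [Matrix.add_mul, Matrix.one_mul, Matrix.smul_mul] at h
  exact eq_sub_of_add_eq h

theorem tendsto_resolvent (X : Matrix m q ℝ) (Y : Matrix q n ℝ) (i : m) (k : n) :
    Filter.Tendsto (fun s => (X * resolvent E s * Y) i k) (nhdsWithin 0 (Set.Ioi 0))
      (nhds ((X * Y) i k)) := by
  have hcont : ContinuousAt (fun s : ℝ => resolvent E s) 0 := by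
    unfold resolvent
    have h1 : Continuous fun s : ℝ => (1 + s • (Eᵀ * E) : Matrix q q ℝ) := by fun_prop
    -- By the adjugate formula, continuity at `s = 0` only needs a non-zero determinant there.
    simp only [Matrix.inv_def, Ring.inverse_eq_inv']
    refine ContinuousAt.smul (ContinuousAt.inv₀ h1.matrix_det.continuousAt ?_)
      h1.matrix_adjugate.continuousAt
    exact (isUnit_det_one_add_smul E le_rfl).ne_zero
  have h0 : resolvent E 0 = 1 := by simp [resolvent]
  have hc : ContinuousAt (fun s => (X * resolvent E s * Y) i k) 0 := by
    have h2 : Continuous fun U : Matrix q q ℝ => (X * U * Y) i k := by fun_prop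
    exact h2.continuousAt.comp hcont
  have h3 := hc.tendsto
  simp only [h0, Matrix.mul_one] at h3
  exact h3.mono_left nhdsWithin_le_nhds

/-- If an entry of `X (1 + s EᵀE)⁻¹ Y` vanishes for all positive `s`, then so do the entries
of all `X (EᵀE)ᵗ Y`. -/
theorem mul_pow_mul_eq_zero_of_resolvent (X : Matrix m q ℝ) (Y : Matrix q n ℝ) {i : m} {k : n}
    (h : ∀ s > 0, (X * resolvent E s * Y) i k = 0) (t : ℕ) :
    (X * (Eᵀ * E) ^ t * Y) i k = 0 := by
  have hlim : ∀ X : Matrix m q ℝ, (∀ s > 0, (X * resolvent E s * Y) i k = 0) →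
      (X * Y) i k = 0 := fun X hX => by
    refine tendsto_nhds_unique (tendsto_resolvent E X Y i k) ?_
    refine tendsto_const_nhds.congr' ?_
    filter_upwards [self_mem_nhdsWithin] with s hs using (hX s hs).symm
  induction t generalizing X with
  | zero => simpa using hlim X h
  | succ t ih =>
    rw [pow_succ', ← Matrix.mul_assoc]
    -- The constant term `X Y` vanishes in the limit `s → 0`; dividing the rest by `s` gives the
    -- same hypothesis with `X EᵀE` in place of `X`.
    refine ih (X * (Eᵀ * E)) fun s hs => ?_
    have h1 := h s hs
    rw [resolvent_eq E hs.le, Matrix.mul_sub, Matrix.sub_mul, Matrix.sub_apply, Matrix.mul_one,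
      hlim X h, zero_sub, neg_eq_zero, Matrix.mul_smul, Matrix.smul_mul, Matrix.smul_apply,
      smul_eq_mul, mul_eq_zero] at h1
    rw [Matrix.mul_assoc X]
    exact h1.resolve_left (ne_of_gt hs)

/-- If all matrices are non-negative and a walk joins the row to the column, then the entry of
`X (1 + s EᵀE)⁻¹ Y` is non-zero for some positive `s`. -/
theorem exists_resolvent_ne_zero {X : Matrix m q ℝ} {Y : Matrix q n ℝ} {i : m} {k : n}
    (hX : ∀ i j, 0 ≤ X i j) (hE : ∀ i j, 0 ≤ E i j) (hY : ∀ i j, 0 ≤ Y i j) {a b : q}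
    (ha : 0 < X i a) (hab : Relation.ReflTransGen (fun a b => ∃ w, 0 < E w a ∧ 0 < E w b) a b)
    (hb : 0 < Y b k) : ∃ s > 0, (X * resolvent E s * Y) i k ≠ 0 := by
  by_contra! h
  have hEE : ∀ i j, 0 ≤ (Eᵀ * E) i j := matrix_mul_nonneg (fun i j => hE j i) hE
  -- The exponent `t` is supplied by the walk: each of its steps is a positive entry of `EᵀE`.
  obtain ⟨t, ht⟩ := exists_matrix_pow_pos hEE (i := a) (j := b)
    (Relation.ReflTransGen.mono (fun a b ⟨w, hw, hw'⟩ =>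
      matrix_mul_pos (fun i j => hE j i) hE (j := w) hw hw') _ _ hab)
  exact (matrix_mul_pos (matrix_mul_nonneg hX (matrix_pow_nonneg hEE t)) hY
    (matrix_mul_pos hX (matrix_pow_nonneg hEE t) ha ht) hb).ne'
    (mul_pow_mul_eq_zero_of_resolvent E X Y h t)

end Resolvent

/-! ### Partial inversion of a weighted Gram matrix -/

section Gram

variable {q v z : Type*} [Fintype q] [DecidableEq q] [Fintype z]
  {Q : Matrix q q ℝ} (B : Matrix q v ℝ) (L : Matrix z q ℝ) (N : Matrix z v ℝ)
  {s : ℝ} (hQ : IsUnit Q.det) (hs : 0 < s)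

include hQ

/-- Pull `Qᵀ` and `Q` out on either side; the middle factor becomes `1 + s EᵀE` with `E = L Q⁻¹`. -/
theorem inv_gram : (Qᵀ * Q + s • (Lᵀ * L))⁻¹ = Q⁻¹ * resolvent (L * Q⁻¹) s * (Q⁻¹)ᵀ := by
  have hQ' : IsUnit (Qᵀ).det := by rwa [Matrix.det_transpose]
  have h : Qᵀ * Q + s • (Lᵀ * L) = Qᵀ * (1 + s • ((L * Q⁻¹)ᵀ * (L * Q⁻¹))) * Q := by
    rw [Matrix.mul_add, Matrix.add_mul, Matrix.mul_one, Matrix.mul_smul, Matrix.smul_mul,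
      Matrix.transpose_mul, Matrix.transpose_nonsing_inv]
    congr 2
    simp only [Matrix.mul_assoc]
    rw [Matrix.nonsing_inv_mul _ hQ, Matrix.mul_one, Matrix.mul_nonsing_inv_cancel_left _ _ hQ']
  rw [h, Matrix.mul_inv_rev, Matrix.mul_inv_rev, Matrix.transpose_nonsing_inv, resolvent,
    Matrix.mul_assoc]

include hs

/-- At `s = 0` the regression coefficient is `Q⁻¹ B`; adding `(Qᵀ Q + s LᵀL) Q⁻¹ B` to the cross
block leaves a multiple of `s`, the correction. -/
theorem regression_gram :
    -((Qᵀ * Q + s • (Lᵀ * L))⁻¹ * (Qᵀ * -B + s • (Lᵀ * N)))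
      = Q⁻¹ * B - s • (Q⁻¹ * resolvent (L * Q⁻¹) s * (L * Q⁻¹)ᵀ * (N + L * Q⁻¹ * B)) := by
  have hQ' : IsUnit (Qᵀ).det := by rwa [Matrix.det_transpose]
  have hK : IsUnit (Qᵀ * Q + s • (Lᵀ * L)).det := by
    have h1 := Matrix.posSemidef_conjTranspose_mul_self L
    have h2 := Matrix.PosDef.conjTranspose_mul_self Q
      (Matrix.mulVec_injective_of_isUnit ((Matrix.isUnit_iff_isUnit_det _).2 hQ))
    rw [Matrix.conjTranspose_eq_transpose_of_trivial] at h1 h2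
    exact (Matrix.isUnit_iff_isUnit_det _).1 (h2.add_posSemidef (h1.smul hs.le)).isUnit
  have e : Qᵀ * -B + s • (Lᵀ * N)
      = s • (Lᵀ * (N + L * Q⁻¹ * B)) - (Qᵀ * Q + s • (Lᵀ * L)) * (Q⁻¹ * B) := by
    rw [Matrix.add_mul, Matrix.mul_assoc Qᵀ, Matrix.mul_nonsing_inv_cancel_left _ _ hQ,
      Matrix.mul_add, smul_add, Matrix.smul_mul]
    simp only [Matrix.mul_assoc, Matrix.mul_neg]
    abel
  rw [e, Matrix.mul_sub, Matrix.nonsing_inv_mul_cancel_left _ _ hK, neg_sub, inv_gram L hQ,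
    Matrix.mul_smul, Matrix.transpose_mul L]
  simp only [Matrix.mul_assoc]

/-- The Gram matrix of `(Q, -B)` alone has Schur complement zero because `Q` is invertible, so a
factor `s` splits off. The leading term is the Gram matrix of `W = N + L Q⁻¹ B`, the effects of `v`
after passing through `q`. -/
theorem schur_gram :
    ((-B)ᵀ * -B + s • (Nᵀ * N))
        - ((-B)ᵀ * Q + s • (Nᵀ * L)) * (Qᵀ * Q + s • (Lᵀ * L))⁻¹ * (Qᵀ * -B + s • (Lᵀ * N))
      = s • ((N + L * Q⁻¹ * B)ᵀ * (N + L * Q⁻¹ * B)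
        - s • ((N + L * Q⁻¹ * B)ᵀ * (L * Q⁻¹) * resolvent (L * Q⁻¹) s
          * ((L * Q⁻¹)ᵀ * (N + L * Q⁻¹ * B)))) := by
  have e1 := regression_gram B L N hQ hs
  rw [Matrix.mul_assoc, sub_eq_add_neg, ← Matrix.mul_neg, e1]
  set E := L * Q⁻¹ with hE
  set W := N + E * B with hW
  have hN : N = W - E * B := by rw [hW]; abel
  have hL : L = E * Q := by rw [hE, Matrix.nonsing_inv_mul_cancel_right _ _ hQ]
  -- Expanding the resolvent once supplies the only non-linear identity needed; after substituting
  -- for `N` and `L` the rest is linear.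
  have hU : resolvent E s * (Eᵀ * W)
      = Eᵀ * W - s • (Eᵀ * (E * (resolvent E s * (Eᵀ * W)))) := by
    conv_lhs => rw [resolvent_eq E hs.le]
    rw [Matrix.sub_mul, Matrix.one_mul, Matrix.smul_mul]
    simp only [Matrix.mul_assoc]
  set V := resolvent E s * (Eᵀ * W) with hV
  have e2 : (-B)ᵀ * Q + s • (Nᵀ * L) = (-Bᵀ + s • (Nᵀ * E)) * Q := by
    rw [Matrix.add_mul, Matrix.smul_mul, Matrix.transpose_neg, Matrix.mul_assoc Nᵀ, ← hL]
  have e3 : Q⁻¹ * B - s • (Q⁻¹ * resolvent E s * Eᵀ * W) = Q⁻¹ * (B - s • V) := by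
    rw [hV, Matrix.mul_sub, Matrix.mul_smul]; simp only [Matrix.mul_assoc]
  rw [e2, e3, Matrix.mul_assoc, Matrix.mul_nonsing_inv_cancel_left _ _ hQ]
  have e4 : Wᵀ * E * resolvent E s * (Eᵀ * W) = Wᵀ * E * V := by
    rw [hV]; simp only [Matrix.mul_assoc]
  rw [e4]
  have e5 : Bᵀ * V = Bᵀ * (Eᵀ * W) - s • (Bᵀ * (Eᵀ * (E * V))) := by
    conv_lhs => rw [hU]
    rw [Matrix.mul_sub, Matrix.mul_smul]
  rw [hN]
  simp only [Matrix.transpose_neg, Matrix.transpose_sub, Matrix.transpose_mul, Matrix.add_mul,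
    Matrix.neg_mul, Matrix.mul_neg, Matrix.mul_sub, Matrix.sub_mul, Matrix.smul_mul,
    Matrix.mul_smul, Matrix.mul_assoc, e5, smul_sub, neg_neg]
  module

end Gram

theorem In_In {m n : Type*} (F : Matrix m n ℝ) : In (In F) = In F := by
  ext i k
  simp [In]

namespace ParentGraph

variable {d : ℕ} (G : ParentGraph d) {C M : Finset (Fin d)}
  {A : Matrix (Fin d) (Fin d) ℝ} {δ : Fin d → ℝ}

/-- The witness in `hcomplete` may depend on the entry, so no single system has to realise all edges
at once. -/
theorem structuralEdgeMatrix_eq_In {m n : Type*}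
    {X : Matrix (Fin d) (Fin d) ℝ → (Fin d → ℝ) → Matrix m n ℝ} {F : Matrix m n ℝ}
    (hsound : ∀ A δ, G.IsTriangularSystem A δ → ∀ i k, X A δ i k ≠ 0 → F i k ≠ 0)
    (hcomplete : ∀ i k, F i k ≠ 0 → ∃ A δ, G.IsTriangularSystem A δ ∧ X A δ i k ≠ 0) :
    G.structuralEdgeMatrix X = In F := by
  ext i k
  simp only [structuralEdgeMatrix, In, Matrix.of_apply]
  congr 1
  refine propext ⟨fun h => ?_, fun h A δ hA => ?_⟩
  · by_contra hne
    obtain ⟨A, δ, hA, hX⟩ := hcomplete i k hne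
    exact hX (h A δ hA)
  · by_contra hne
    exact hsound A δ hA i k hne h

/-! ### Edges implied by non-zero parameters -/

theorem edgeConFF_ne_zero_iff {i k : G.foster C} : G.edgeConFF C i k ≠ 0 ↔
    ∃ r ∈ G.right C, G.edgeMatrix r i ≠ 0 ∧ G.edgeMatrix r k ≠ 0 := by
  rw [edgeConFF, Matrix.submatrix_apply, In_ne_zero_iff, Matrix.mul_apply]
  refine (sum_ne_zero_iff_of_nonneg fun r =>
    mul_nonneg (G.edgeMatrix_nonneg _ _) (G.edgeMatrix_nonneg _ _)).trans ?_
  simp only [mul_ne_zero_iff]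
  exact ⟨fun ⟨r, h⟩ => ⟨r, r.2, h⟩, fun ⟨r, hr, h⟩ => ⟨⟨r, hr⟩, h⟩⟩

theorem edgeConFF_nonneg (i k : G.foster C) : 0 ≤ G.edgeConFF C i k := In_nonneg _ _ _

theorem edgeConFF_le_one (i k : G.foster C) : G.edgeConFF C i k ≤ 1 := In_le_one _ _ _

theorem edgeD_nonneg (i k : Fin d) : 0 ≤ G.edgeD C M i k := partialClosure_nonneg _ _ _ _

theorem zerConFF_nonneg (i k : G.foster C) : 0 ≤ G.zerConFF C M i k :=
  partialClosure_nonneg _ _ _ _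

namespace IsTriangularSystem

variable {G} (hA : G.IsTriangularSystem A δ)

include hA

theorem edgeD_ne_zero {i k : Fin d} (h : G.paramD C M A i k ≠ 0) : G.edgeD C M i k ≠ 0 :=
  partialClosure_ne_zero_of_partialInv_ne_zero G.edgeMatrix_nonneg G.edgeMatrix_le_one
    (fun _ _ => hA.edgeMatrix_ne_zero) h

theorem zerConFF_ne_zero {i k : G.foster C} (h : G.invConFF C M A δ i k ≠ 0) :
    G.zerConFF C M i k ≠ 0 := by
  refine partialClosure_ne_zero_of_partialInv_ne_zero G.edgeConFF_nonneg G.edgeConFF_le_one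
    (fun i k hik => ?_) h
  rw [hA.conFF_eq, blk_apply, conc, Matrix.of_apply] at hik
  obtain ⟨r, hr, hne⟩ := Finset.exists_ne_zero_of_sum_ne_zero hik
  rw [mul_ne_zero_iff, mul_ne_zero_iff] at hne
  exact G.edgeConFF_ne_zero_iff.2
    ⟨r, hr, hA.edgeMatrix_ne_zero hne.1.1, hA.edgeMatrix_ne_zero hne.1.2⟩

end IsTriangularSystem

variable (C M) in
/-- `D_uv + D_uq P_{q|v.C}`, for edge matrices. -/
def edgeHuv : Matrix (G.u C M) (G.v C M) ℝ :=
  blk (G.edgeD C M) (G.u C M) (G.v C M)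
    + blk (G.edgeD C M) (G.u C M) (G.q C M) * G.edgePqv C M

variable (C M) in
/-- `(I_uu + D_up D_upᵀ) + D_uq S_{qq|vC} D_uqᵀ`, for edge matrices. -/
def edgeWuu : Matrix (G.u C M) (G.u C M) ℝ :=
  (1 + blk (G.edgeD C M) (G.u C M) (G.p C M) * (blk (G.edgeD C M) (G.u C M) (G.p C M))ᵀ)
    + blk (G.edgeD C M) (G.u C M) (G.q C M) * G.edgeSqq C M
      * (blk (G.edgeD C M) (G.u C M) (G.q C M))ᵀ

theorem mul_edgePqv_nonneg (i : G.u C M) (k : G.v C M) :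
    0 ≤ (blk (G.edgeD C M) (G.u C M) (G.q C M) * G.edgePqv C M) i k :=
  matrix_mul_nonneg (fun _ _ => G.edgeD_nonneg _ _) (fun _ _ => G.zerConFF_nonneg _ _) i k

theorem edgeHuv_ne_zero_iff {i : G.u C M} {k : G.v C M} :
    G.edgeHuv C M i k ≠ 0 ↔
      G.edgeD C M i k ≠ 0 ∨
        ∃ x : G.q C M, G.edgeD C M i x ≠ 0 ∧ G.edgePqv C M x k ≠ 0 := by
  have h : 0 ≤ blk (G.edgeD C M) (G.u C M) (G.v C M) i k := G.edgeD_nonneg _ _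
  rw [edgeHuv, Matrix.add_apply, Ne, add_eq_zero_iff_of_nonneg h
    (G.mul_edgePqv_nonneg i k), not_and_or, Matrix.mul_apply]
  refine or_congr Iff.rfl ((sum_ne_zero_iff_of_nonneg fun x =>
    mul_nonneg (G.edgeD_nonneg _ _) (G.zerConFF_nonneg _ _)).trans ?_)
  simp only [mul_ne_zero_iff]
  rfl

theorem edgeWuu_ne_zero_iff {i k : G.u C M} :
    G.edgeWuu C M i k ≠ 0 ↔
      i = k ∨ (∃ x : G.p C M, G.edgeD C M i x ≠ 0 ∧ G.edgeD C M k x ≠ 0) ∨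
        ∃ x y : G.q C M, G.edgeD C M i x ≠ 0 ∧ G.edgeSqq C M x y ≠ 0 ∧ G.edgeD C M k y ≠ 0 := by
  have hD : ∀ (a b : Finset (Fin d)) (i : a) (j : b), 0 ≤ blk (G.edgeD C M) a b i j :=
    fun _ _ _ _ => G.edgeD_nonneg _ _
  have hD' : ∀ (a b : Finset (Fin d)) (i : a) (j : b), 0 ≤ (blk (G.edgeD C M) b a)ᵀ i j :=
    fun _ _ _ _ => G.edgeD_nonneg _ _
  have hS : ∀ x y, 0 ≤ G.edgeSqq C M x y := fun _ _ => G.zerConFF_nonneg _ _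
  have h1 : 0 ≤ (1 : Matrix (G.u C M) (G.u C M) ℝ) i k := by
    rw [Matrix.one_apply]; split_ifs <;> norm_num
  have h2 := matrix_mul_nonneg (hD (G.u C M) (G.p C M)) (hD' _ _) i k
  have h3' := matrix_mul_nonneg (hD (G.u C M) (G.q C M)) hS
  have h3 := matrix_mul_nonneg h3' (hD' _ _) i k
  rw [edgeWuu, Matrix.add_apply, Matrix.add_apply, Ne,
    add_eq_zero_iff_of_nonneg (add_nonneg h1 h2) h3,
    add_eq_zero_iff_of_nonneg h1 h2, not_and_or, not_and_or, or_assoc]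
  refine or_congr ?_ (or_congr ?_ ?_)
  · rw [Matrix.one_apply]; split_ifs with hik <;> simp [hik]
  · rw [Matrix.mul_apply]
    refine (sum_ne_zero_iff_of_nonneg fun x => mul_nonneg (hD _ _ _ _) (hD _ _ _ _)).trans ?_
    simp only [mul_ne_zero_iff]
    rfl
  · rw [Matrix.mul_apply]
    refine (sum_ne_zero_iff_of_nonneg fun y => mul_nonneg (h3' _ _) (hD _ _ _ _)).trans ?_
    simp only [mul_ne_zero_iff, Matrix.mul_apply]
    constructor
    · rintro ⟨y, hy, hk⟩
      obtain ⟨x, hx⟩ := (sum_ne_zero_iff_of_nonneg fun x =>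
        mul_nonneg (hD _ _ _ _) (hS _ _)).1 hy
      rw [mul_ne_zero_iff] at hx
      exact ⟨x, y, hx.1, hx.2, hk⟩
    · rintro ⟨x, y, hx, hxy, hy⟩
      exact ⟨y, (sum_ne_zero_iff_of_nonneg fun x => mul_nonneg (hD _ _ _ _) (hS _ _)).2
        ⟨x, mul_ne_zero hx hxy⟩, hy⟩

namespace IsTriangularSystem

variable {G} (hA : G.IsTriangularSystem A δ)

include hA

theorem edgeHuv_ne_zero {i : G.u C M} {k : G.v C M} (h : G.paramHuv C M A δ i k ≠ 0) :
    G.edgeHuv C M i k ≠ 0 := by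
  rw [G.edgeHuv_ne_zero_iff]
  by_cases h1 : G.paramD C M A i k = 0
  · right
    have h2 : (blk (G.paramD C M A) (G.u C M) (G.q C M) * G.piQV C M A δ) i k ≠ 0 := by
      intro h0
      apply h
      rw [paramHuv, Matrix.add_apply, h0, add_zero]
      exact h1
    obtain ⟨x, -, hx⟩ := Finset.exists_ne_zero_of_sum_ne_zero h2
    rw [mul_ne_zero_iff] at hx
    exact ⟨x, hA.edgeD_ne_zero hx.1, hA.zerConFF_ne_zero hx.2⟩
  · exact Or.inl (hA.edgeD_ne_zero h1)

theorem edgeWuu_ne_zero {i k : G.u C M} (h : G.paramWuu C M A δ i k ≠ 0) :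
    G.edgeWuu C M i k ≠ 0 := by
  rw [G.edgeWuu_ne_zero_iff]
  by_contra! hc
  obtain ⟨hik, hp, hq⟩ := hc
  apply h
  rw [paramWuu, Matrix.add_apply, Matrix.add_apply]
  have h1 : blk (diagonal δ) (G.u C M) (G.u C M) i k = 0 :=
    Matrix.diagonal_apply_ne _ fun h => hik (Subtype.ext h)
  have h2 : (blk (G.paramD C M A) (G.u C M) (G.p C M) * blk (diagonal δ) (G.p C M) (G.p C M)
      * (blk (G.paramD C M A) (G.u C M) (G.p C M))ᵀ) i k = 0 := by
    by_contra hne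
    obtain ⟨y, -, hy⟩ := Finset.exists_ne_zero_of_sum_ne_zero hne
    rw [mul_ne_zero_iff] at hy
    obtain ⟨x, -, hx⟩ := Finset.exists_ne_zero_of_sum_ne_zero hy.1
    rw [mul_ne_zero_iff] at hx
    have hxy : x = y := by
      by_contra hxy
      exact hx.2 (Matrix.diagonal_apply_ne _ fun h => hxy (Subtype.ext h))
    subst hxy
    exact hA.edgeD_ne_zero hy.2 (hp x (hA.edgeD_ne_zero hx.1))
  have h3 : (blk (G.paramD C M A) (G.u C M) (G.q C M) * G.sigmaQQ C M A δ
      * (blk (G.paramD C M A) (G.u C M) (G.q C M))ᵀ) i k = 0 := by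
    by_contra hne
    obtain ⟨y, -, hy⟩ := Finset.exists_ne_zero_of_sum_ne_zero hne
    rw [mul_ne_zero_iff] at hy
    obtain ⟨x, -, hx⟩ := Finset.exists_ne_zero_of_sum_ne_zero hy.1
    rw [mul_ne_zero_iff] at hx
    exact hA.edgeD_ne_zero hy.2
      (hq x y (hA.edgeD_ne_zero hx.1) (hA.zerConFF_ne_zero hx.2))
  rw [h1, h2, h3]
  norm_num

end IsTriangularSystem

end ParentGraph

namespace ParentGraph

variable {d : ℕ} (G : ParentGraph d) (C M : Finset (Fin d))

/-! ### A family of triangular systems without cancellation -/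

/-- The nodes of `R` outside `q`. -/
def observed : Finset (Fin d) := G.right C \ G.q C M

open Classical in
/-- The matrix over the parent graph whose regression coefficients are `-1` for responses in
`R ∖ q` and `1` for all other responses. -/
def testMatrix : Matrix (Fin d) (Fin d) ℝ :=
  Matrix.of fun i k =>
    if i = k then 1 else if G.edge i k then (if i ∈ G.observed C M then 1 else -1) else 0

/-- Residual variances that are `s⁻¹` on `R ∖ q` and one elsewhere. -/
def testVar (s : ℝ) : Fin d → ℝ := fun i => if i ∈ G.observed C M then s⁻¹ else 1

variable {C M}

theorem testMatrix_ne_zero_iff {i k : Fin d} :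
    G.testMatrix C M i k ≠ 0 ↔ G.edgeMatrix i k ≠ 0 := by
  rw [G.edgeMatrix_ne_zero_iff]
  simp only [testMatrix, Matrix.of_apply]
  split_ifs with h1 h2 h3 <;> simp [*]

theorem isTriangularSystem_test {s : ℝ} (hs : 0 < s) :
    G.IsTriangularSystem (G.testMatrix C M) (G.testVar C M s) where
  diag i := by simp [testMatrix]
  indicator := by
    ext i k
    have h := G.testMatrix_ne_zero_iff (C := C) (M := M) (i := i) (k := k)
    rw [G.edgeMatrix_ne_zero_iff] at h
    by_cases h' : i = k ∨ G.edge i k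
    · simp [In, edgeMatrix, h', h.2 h']
    · simp [In, edgeMatrix, h', not_not.1 fun hne => h' (h.1 hne)]
  pos i := by
    simp only [testVar]
    split_ifs
    · exact inv_pos.2 hs
    · exact one_pos

theorem testMatrix_nonneg {i : Fin d} (hi : i ∈ G.observed C M) (k : Fin d) :
    0 ≤ G.testMatrix C M i k := by
  simp only [testMatrix, Matrix.of_apply, hi]
  split_ifs <;> norm_num

theorem testMatrix_pos {i k : Fin d} (hi : i ∈ G.observed C M) (h : G.edgeMatrix i k ≠ 0) :
    0 < G.testMatrix C M i k :=
  (G.testMatrix_nonneg hi k).lt_of_ne' (G.testMatrix_ne_zero_iff.2 h)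

theorem testMatrix_nonpos {i k : Fin d} (hi : i ∉ G.observed C M) (hik : i ≠ k) :
    G.testMatrix C M i k ≤ 0 := by
  simp only [testMatrix, Matrix.of_apply, hi, hik]
  split_ifs <;> first | contradiction | norm_num

theorem testMatrix_neg {i k : Fin d} (hi : i ∉ G.observed C M) (hik : i ≠ k)
    (h : G.edgeMatrix i k ≠ 0) : G.testMatrix C M i k < 0 :=
  (G.testMatrix_nonpos hi hik).lt_of_ne (G.testMatrix_ne_zero_iff.2 h)

theorem notMem_observed_of_mem_outsiders {i : Fin d} (hi : i ∈ G.outsiders C) :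
    i ∉ G.observed C M := fun h =>
  G.mem_outsiders_iff_notMem.1 hi (Finset.mem_sdiff.1 h).1

theorem notMem_observed_of_mem_q {i : Fin d} (hi : i ∈ G.q C M) : i ∉ G.observed C M := fun h =>
  (Finset.mem_sdiff.1 h).2 hi

theorem isUnit_det_blk_test (a : Finset (Fin d)) :
    IsUnit (blk (G.testMatrix C M) a a).det :=
  (G.isTriangularSystem_test one_pos).isUnit_det_blk a

section Block

variable {a : Finset (Fin d)} (ha : ∀ i ∈ a, i ∉ G.observed C M)

include ha

/-- Rows outside `R ∖ q` have non-positive off-diagonal entries, so the inverse sums path weights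
that are all positive. -/
theorem inv_blk_test_nonneg (x y : a) : 0 ≤ (blk (G.testMatrix C M) a a)⁻¹ x y :=
  inv_nonneg_of_unitUpper (X := blk (G.testMatrix C M) a a)
    (fun i => (G.isTriangularSystem_test (M := M) one_pos).diag i)
    (fun _ _ h => (G.isTriangularSystem_test (M := M) one_pos).eq_zero_of_lt h)
    (fun i _ h => G.testMatrix_nonpos (ha i i.2) fun h' => h (Subtype.ext h')) x y

theorem inv_blk_test_pos {x y : a}
    (h : Relation.ReflTransGen (fun x y : a => G.edgeMatrix x y ≠ 0) x y) :
    0 < (blk (G.testMatrix C M) a a)⁻¹ x y := by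
  refine inv_pos_of_reflTransGen (G.isUnit_det_blk_test a) (fun i => ?_) (fun i j hij => ?_)
    (G.inv_blk_test_nonneg ha) ?_
  · rw [blk_apply, (G.isTriangularSystem_test (M := M) one_pos).diag]
    exact one_pos
  · exact G.testMatrix_nonpos (ha i i.2) fun h' => hij (Subtype.ext h')
  · exact Relation.ReflTransGen.mono (fun x y hxy => G.testMatrix_ne_zero_iff.2 hxy) _ _ h

omit ha in
theorem reflTransGen_of_inv_blk_test_pos {x y : a}
    (h : 0 < (blk (G.testMatrix C M) a a)⁻¹ x y) :
    Relation.ReflTransGen (fun x y : a => G.edgeMatrix x y ≠ 0) x y :=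
  reflTransGen_of_inv_ne_zero (fun _ _ hij => G.testMatrix_ne_zero_iff.1 hij) h.ne'

end Block

theorem notMem_observed_of_mem_p : ∀ i ∈ G.p C M, i ∉ G.observed C M := fun _ hi =>
  G.notMem_observed_of_mem_outsiders (G.mem_outsiders_of_mem_p hi)

theorem notMem_observed_of_mem_u : ∀ i ∈ G.u C M, i ∉ G.observed C M := fun _ hi =>
  G.notMem_observed_of_mem_outsiders (G.mem_outsiders_of_mem_u hi)

theorem inv_blk_test_pos_of_reach {x y : G.p C M} (h : Reach (G.p C M) G.edgeMatrix x y) :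
    0 < (blk (G.testMatrix C M) (G.p C M) (G.p C M))⁻¹ x y :=
  G.inv_blk_test_pos G.notMem_observed_of_mem_p h.2.2

/-! ### Signs of `inv_p A` in the test systems -/

section TestD

variable {i k : Fin d} (hi : i ∈ G.u C M)

include hi

theorem testMatrix_u_p_nonpos (x : G.p C M) : G.testMatrix C M i x ≤ 0 :=
  G.testMatrix_nonpos (G.notMem_observed_of_mem_u i hi) fun h =>
    G.notMem_p_of_mem_u hi (h ▸ x.2)

theorem testMatrix_u_p_neg {x : G.p C M} (h : G.edgeMatrix i x ≠ 0) :
    G.testMatrix C M i x < 0 :=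
  (G.testMatrix_u_p_nonpos hi x).lt_of_ne (G.testMatrix_ne_zero_iff.2 h)

theorem sum_test_nonpos (y : G.p C M) : ∑ x : G.p C M, G.testMatrix C M i x
    * (blk (G.testMatrix C M) (G.p C M) (G.p C M))⁻¹ x y ≤ 0 :=
  Finset.sum_nonpos fun x _ => mul_nonpos_of_nonpos_of_nonneg (G.testMatrix_u_p_nonpos hi x)
    (G.inv_blk_test_nonneg G.notMem_observed_of_mem_p x y)

theorem sum_test_neg {x y : G.p C M} (hx : G.edgeMatrix i x ≠ 0)
    (hxy : Reach (G.p C M) G.edgeMatrix x y) : ∑ x : G.p C M, G.testMatrix C M i x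
    * (blk (G.testMatrix C M) (G.p C M) (G.p C M))⁻¹ x y < 0 :=
  Finset.sum_neg' (fun x _ => mul_nonpos_of_nonpos_of_nonneg (G.testMatrix_u_p_nonpos hi x)
    (G.inv_blk_test_nonneg G.notMem_observed_of_mem_p x y))
    ⟨x, Finset.mem_univ x, mul_neg_of_neg_of_pos (G.testMatrix_u_p_neg hi hx)
      (G.inv_blk_test_pos_of_reach hxy)⟩

/-- Direct arrows and paths through `p` contribute with the same sign: `A_ik ≤ 0`, and one subtracts
the product of the non-positive `A_ip A_pp⁻¹` and `A_pk`. The condition `i ≠ k` excludes the unit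
diagonal. -/
theorem paramD_test_nonpos (hik : i ≠ k) : G.paramD C M (G.testMatrix C M) i k ≤ 0 := by
  have hip := G.notMem_p_of_mem_u hi
  by_cases hk : k ∈ G.p C M
  · rw [G.paramD_notMem_mem hip hk]
    exact G.sum_test_nonpos hi _
  · rw [G.paramD_notMem_notMem hip hk]
    have h1 := G.testMatrix_nonpos (G.notMem_observed_of_mem_u i hi) hik
    have h2 := Finset.sum_nonneg fun (y : G.p C M) (_ : y ∈ Finset.univ) =>
      mul_nonneg_of_nonpos_of_nonpos (G.sum_test_nonpos hi y)
        (G.testMatrix_nonpos (G.notMem_observed_of_mem_p y y.2) (k := k) fun h => hk (h ▸ y.2))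
    linarith

theorem paramD_test_neg (hik : i ≠ k) (h : G.edgeD C M i k ≠ 0) :
    G.paramD C M (G.testMatrix C M) i k < 0 := by
  have hip := G.notMem_p_of_mem_u hi
  by_cases hk : k ∈ G.p C M
  · rw [edgeD, partialClosure_notMem_mem G.edgeMatrix_nonneg G.edgeMatrix_le_one hip hk] at h
    obtain ⟨x, hx, hxk⟩ := h
    rw [G.paramD_notMem_mem hip hk]
    exact G.sum_test_neg hi (x := ⟨x, hxk.1⟩) hx hxk
  · rw [edgeD, partialClosure_notMem_notMem G.edgeMatrix_nonneg G.edgeMatrix_le_one hip hk] at h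
    rw [G.paramD_notMem_notMem hip hk]
    have hterm := fun (y : G.p C M) (_ : y ∈ Finset.univ) =>
      mul_nonneg_of_nonpos_of_nonpos (G.sum_test_nonpos hi y)
        (G.testMatrix_nonpos (G.notMem_observed_of_mem_p y y.2) (k := k) fun h => hk (h ▸ y.2))
    rcases h with h | ⟨x, y, hx, hxy, hy⟩
    · have h1 := G.testMatrix_neg (G.notMem_observed_of_mem_u i hi) hik h
      linarith [Finset.sum_nonneg hterm]
    · have h1 := G.testMatrix_nonpos (G.notMem_observed_of_mem_u i hi) hik
      have h2 := Finset.sum_pos' hterm ⟨⟨y, hxy.2.1⟩, Finset.mem_univ _,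
        mul_pos_of_neg_of_neg (G.sum_test_neg hi (x := ⟨x, hxy.1⟩) hx hxy)
          (G.testMatrix_neg (G.notMem_observed_of_mem_p y hxy.2.1)
            (fun h => hk (h ▸ hxy.2.1)) hy)⟩
      linarith

end TestD

theorem ne_of_mem_u_of_mem_right {i k : Fin d} (hi : i ∈ G.u C M) (hk : k ∈ G.right C) : i ≠ k :=
  fun h => G.notMem_u_of_mem_right hk (h ▸ hi)

theorem ne_of_mem_u_of_mem_p {i k : Fin d} (hi : i ∈ G.u C M) (hk : k ∈ G.p C M) : i ≠ k :=
  fun h => G.notMem_p_of_mem_u hi (h ▸ hk)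

/-! ### Parameters of the test systems -/

/-- The inverse variances are `1` on `q` and `s` on `R ∖ q`, which puts the concentration matrix in
the weighted Gram form treated above. -/
theorem blk_conc_test (a b : Finset (Fin d)) (s : ℝ) :
    blk (G.conc C (G.testMatrix C M) (G.testVar C M s)) a b
      = (blk (G.testMatrix C M) (G.q C M) a)ᵀ * blk (G.testMatrix C M) (G.q C M) b
        + s • ((blk (G.testMatrix C M) (G.observed C M) a)ᵀ
          * blk (G.testMatrix C M) (G.observed C M) b) := by
  ext i k
  simp only [blk_apply, conc, Matrix.of_apply, Matrix.add_apply, Matrix.smul_apply,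
    Matrix.mul_apply, Matrix.transpose_apply, smul_eq_mul]
  have hsub : G.q C M ⊆ G.right C := fun _ => G.mem_right_of_mem_q
  rw [← Finset.sum_sdiff hsub, add_comm, Finset.mul_sum,
    Finset.sum_coe_sort (G.q C M) (fun r => G.testMatrix C M r i * G.testMatrix C M r k),
    Finset.sum_coe_sort (G.observed C M)
      (fun r => s * (G.testMatrix C M r i * G.testMatrix C M r k))]
  refine congrArg₂ (· + ·) (Finset.sum_congr rfl fun r hr => ?_)
    (Finset.sum_congr rfl fun r hr => ?_)
  · rw [testVar, if_neg (G.notMem_observed_of_mem_q hr), inv_one, mul_one]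
  · rw [testVar, if_pos hr, inv_inv, mul_comm]

variable (C M) in
/-- `A_qq⁻¹` in the test systems. -/
def testT : Matrix (G.q C M) (G.q C M) ℝ := (blk (G.testMatrix C M) (G.q C M) (G.q C M))⁻¹

variable (C M) in
/-- `-A_qv` in the test systems. -/
def testB : Matrix (G.q C M) (G.v C M) ℝ := -blk (G.testMatrix C M) (G.q C M) (G.v C M)

variable (C M) in
/-- The effects of `q` on `R ∖ q`, up to sign, in the test systems. -/
def testE : Matrix (G.observed C M) (G.q C M) ℝ :=
  blk (G.testMatrix C M) (G.observed C M) (G.q C M) * G.testT C M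

variable (C M) in
/-- The effects of `v` on `R ∖ q` after marginalising over `q`, up to sign, in the test
systems. -/
def testN : Matrix (G.observed C M) (G.v C M) ℝ :=
  blk (G.testMatrix C M) (G.observed C M) (G.v C M) + G.testE C M * G.testB C M

section Params

variable {s : ℝ} (hs : 0 < s)

include hs

theorem sigmaQQ_test : G.sigmaQQ C M (G.testMatrix C M) (G.testVar C M s)
    = G.testT C M * resolvent (G.testE C M) s * (G.testT C M)ᵀ := by
  rw [(G.isTriangularSystem_test hs).sigmaQQ_eq, blk_conc_test]
  exact inv_gram _ (G.isUnit_det_blk_test _)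

theorem piQV_test : G.piQV C M (G.testMatrix C M) (G.testVar C M s)
    = G.testT C M * G.testB C M
      - s • (G.testT C M * resolvent (G.testE C M) s * (G.testE C M)ᵀ * G.testN C M) := by
  have h := regression_gram (G.testB C M) (blk (G.testMatrix C M) (G.observed C M) (G.q C M))
    (blk (G.testMatrix C M) (G.observed C M) (G.v C M))
    (G.isUnit_det_blk_test (C := C) (M := M) (G.q C M)) hs
  rw [(G.isTriangularSystem_test hs).piQV_eq, blk_conc_test, blk_conc_test]
  rw [show -G.testB C M = blk (G.testMatrix C M) (G.q C M) (G.v C M) from neg_neg _] at h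
  exact h

theorem sigmaVV_test : G.sigmaVV C M (G.testMatrix C M) (G.testVar C M s)
    = s • ((G.testN C M)ᵀ * G.testN C M - s • ((G.testN C M)ᵀ * G.testE C M
      * resolvent (G.testE C M) s * ((G.testE C M)ᵀ * G.testN C M))) := by
  have h := schur_gram (G.testB C M) (blk (G.testMatrix C M) (G.observed C M) (G.q C M))
    (blk (G.testMatrix C M) (G.observed C M) (G.v C M))
    (G.isUnit_det_blk_test (C := C) (M := M) (G.q C M)) hs
  rw [(G.isTriangularSystem_test hs).sigmaVV_eq, blk_conc_test, blk_conc_test, blk_conc_test,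
    blk_conc_test]
  rw [show -G.testB C M = blk (G.testMatrix C M) (G.q C M) (G.v C M) from neg_neg _] at h
  exact h

end Params

theorem testT_nonneg (x y : G.q C M) : 0 ≤ G.testT C M x y :=
  G.inv_blk_test_nonneg (fun _ => G.notMem_observed_of_mem_q) x y

theorem testT_pos_iff {x y : G.q C M} : 0 < G.testT C M x y ↔
    Relation.ReflTransGen (fun x y : G.q C M => G.edgeMatrix x y ≠ 0) x y :=
  ⟨G.reflTransGen_of_inv_blk_test_pos,
    G.inv_blk_test_pos fun _ => G.notMem_observed_of_mem_q⟩

theorem testB_nonneg (x : G.q C M) (y : G.v C M) : 0 ≤ G.testB C M x y :=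
  neg_nonneg.2 (G.testMatrix_nonpos (G.notMem_observed_of_mem_q x.2)
    (G.ne_of_mem_q_of_mem_v x.2 y.2))

theorem testB_pos {x : G.q C M} {y : G.v C M} (h : G.edgeMatrix x y ≠ 0) :
    0 < G.testB C M x y :=
  neg_pos.2 (G.testMatrix_neg (G.notMem_observed_of_mem_q x.2)
    (G.ne_of_mem_q_of_mem_v x.2 y.2) h)

theorem testE_nonneg (z : G.observed C M) (x : G.q C M) : 0 ≤ G.testE C M z x :=
  matrix_mul_nonneg (fun z _ => G.testMatrix_nonneg z.2 _) G.testT_nonneg z x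

theorem testN_nonneg (z : G.observed C M) (y : G.v C M) : 0 ≤ G.testN C M z y :=
  add_nonneg (G.testMatrix_nonneg z.2 _) (matrix_mul_nonneg G.testE_nonneg G.testB_nonneg z y)

theorem testE_pos_of_edge {z : G.observed C M} {x : G.q C M} (h : G.edgeMatrix z x ≠ 0) :
    0 < G.testE C M z x :=
  matrix_mul_pos (fun z _ => G.testMatrix_nonneg z.2 _) G.testT_nonneg (j := x)
    (G.testMatrix_pos z.2 h) (G.testT_pos_iff.2 .refl)

theorem testE_pos_trans {z : G.observed C M} {x y : G.q C M} (h : 0 < G.testE C M z x)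
    (hxy : 0 < G.testT C M x y) : 0 < G.testE C M z y := by
  have hL : ∀ (z : G.observed C M) (x : G.q C M),
      0 ≤ blk (G.testMatrix C M) (G.observed C M) (G.q C M) z x := fun z _ =>
    G.testMatrix_nonneg z.2 _
  obtain ⟨w, hw, hwx⟩ := exists_pos_of_matrix_mul_pos hL G.testT_nonneg h
  exact matrix_mul_pos hL G.testT_nonneg hw
    (G.testT_pos_iff.2 ((G.testT_pos_iff.1 hwx).trans (G.testT_pos_iff.1 hxy)))

theorem testN_pos_of_edge {z : G.observed C M} {y : G.v C M} (h : G.edgeMatrix z y ≠ 0) :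
    0 < G.testN C M z y :=
  add_pos_of_pos_of_nonneg (G.testMatrix_pos z.2 h)
    (matrix_mul_nonneg G.testE_nonneg G.testB_nonneg z y)

theorem testN_pos_of_testE {z : G.observed C M} {x : G.q C M} {y : G.v C M}
    (h : 0 < G.testE C M z x) (hxy : G.edgeMatrix x y ≠ 0) : 0 < G.testN C M z y :=
  add_pos_of_nonneg_of_pos (G.testMatrix_nonneg z.2 _)
    (matrix_mul_pos G.testE_nonneg G.testB_nonneg h (G.testB_pos hxy))

/-- Every node of `q` has an effect on a node of `R ∖ q`, being an ancestor of `C`. -/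
theorem exists_testE_pos (x : G.q C M) : ∃ z, 0 < G.testE C M z x := by
  have hx : ∃ c ∈ C, G.IsAncestor x c := by
    have h := G.q_subset_foster C M x.2
    simp only [foster, Finset.mem_filter] at h
    exact h.2.2
  obtain ⟨c, hc, hcx⟩ := hx
  -- One step along a path from `c ∈ C` up to `x`: from `b ∈ R ∖ q` the arrow is itself an effect on
  -- `b`; from `b ∈ q` the effect already found for `b` extends to its parent `y`.
  have hstep : ∀ b y, b ∈ G.right C → G.edge b y → (hy : y ∈ G.q C M) →
      (∀ hb : b ∈ G.q C M, ∃ z, 0 < G.testE C M z ⟨b, hb⟩) →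
      ∃ z, 0 < G.testE C M z ⟨y, hy⟩ := by
    intro b y hbR hby hy ih
    have he : G.edgeMatrix b y ≠ 0 := G.edgeMatrix_ne_zero_iff.2 (Or.inr hby)
    by_cases hb : b ∈ G.q C M
    · obtain ⟨z, hz⟩ := ih hb
      exact ⟨z, G.testE_pos_trans hz (G.testT_pos_iff.2 (.single he))⟩
    · exact ⟨⟨b, Finset.mem_sdiff.2 ⟨hbR, hb⟩⟩, G.testE_pos_of_edge he⟩
  have hcR : c ∈ G.right C := G.mem_right_iff.2 (Or.inl hc)
  have key : ∀ y, Relation.TransGen G.edge c y →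
      y ∈ G.right C ∧ ∀ hy : y ∈ G.q C M, ∃ z, 0 < G.testE C M z ⟨y, hy⟩ := by
    intro y h
    induction h with
    | single h =>
      exact ⟨G.mem_right_of_edge hcR h, fun hy => hstep _ _ hcR h hy fun hb =>
        absurd hc (G.notMem_of_mem_foster (G.q_subset_foster C M hb))⟩
    | tail _ h ih =>
      exact ⟨G.mem_right_of_edge ih.1 h, fun hy => hstep _ _ ih.1 h hy ih.2⟩
  exact (key x hcx).2 x.2

/-! ### Walks in the concentration graph and the test systems -/

variable (C) in
/-- Two nodes are adjacent or equal in the concentration graph of `Y_R`. -/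
def Moral (i k : Fin d) : Prop :=
  ∃ r ∈ G.right C, G.edgeMatrix r i ≠ 0 ∧ G.edgeMatrix r k ≠ 0

variable (C M) in
/-- Two nodes of `q` have an effect on a common node of `R ∖ q`. -/
def Coupled (a b : G.q C M) : Prop := ∃ z, 0 < G.testE C M z a ∧ 0 < G.testE C M z b

variable (C M) in
/-- Two nodes of `q` have ancestors in `q` that are joined by a walk of couplings. -/
def Linked (x y : G.q C M) : Prop :=
  ∃ a b, 0 < G.testT C M x a ∧ Relation.ReflTransGen (G.Coupled C M) a b ∧ 0 < G.testT C M y b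

variable {G}

theorem moral_of_edgeConFF_ne_zero {i k : G.foster C} (h : G.edgeConFF C i k ≠ 0) :
    G.Moral C i k := G.edgeConFF_ne_zero_iff.1 h

theorem Moral.symm {i k : Fin d} (h : G.Moral C i k) : G.Moral C k i := by
  obtain ⟨r, hr, h1, h2⟩ := h
  exact ⟨r, hr, h2, h1⟩

/-- A common child in `R ∖ q` is the required node; a common child in `q` passes both effects on to
a node of `R ∖ q` which it affects. -/
theorem Moral.coupled {x y : G.q C M} (h : G.Moral C x y) : G.Coupled C M x y := by
  obtain ⟨r, hr, hx, hy⟩ := h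
  by_cases hrq : r ∈ G.q C M
  · obtain ⟨z, hz⟩ := G.exists_testE_pos ⟨r, hrq⟩
    exact ⟨z, G.testE_pos_trans hz (G.testT_pos_iff.2 (.single hx)),
      G.testE_pos_trans hz (G.testT_pos_iff.2 (.single hy))⟩
  · exact ⟨⟨r, Finset.mem_sdiff.2 ⟨hr, hrq⟩⟩, G.testE_pos_of_edge hx, G.testE_pos_of_edge hy⟩

theorem Moral.exists_testE_testN {x k : Fin d} (h : G.Moral C x k) (hxq : x ∈ G.q C M)
    (hkv : k ∈ G.v C M) {b : G.q C M} (hxb : 0 < G.testT C M ⟨x, hxq⟩ b) :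
    ∃ z, 0 < G.testE C M z b ∧ 0 < G.testN C M z ⟨k, hkv⟩ := by
  obtain ⟨r, hr, hx, hk⟩ := h
  by_cases hrq : r ∈ G.q C M
  · obtain ⟨z, hz⟩ := G.exists_testE_pos ⟨r, hrq⟩
    exact ⟨z, G.testE_pos_trans (G.testE_pos_trans hz (G.testT_pos_iff.2 (.single hx))) hxb,
      G.testN_pos_of_testE hz hk⟩
  · exact ⟨⟨r, Finset.mem_sdiff.2 ⟨hr, hrq⟩⟩, G.testE_pos_trans (G.testE_pos_of_edge hx) hxb,
      G.testN_pos_of_edge hk⟩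

theorem Moral.exists_testN_testN {i k : G.v C M} (h : G.Moral C i k) :
    ∃ z, 0 < G.testN C M z i ∧ 0 < G.testN C M z k := by
  obtain ⟨r, hr, hi, hk⟩ := h
  by_cases hrq : r ∈ G.q C M
  · obtain ⟨z, hz⟩ := G.exists_testE_pos ⟨r, hrq⟩
    exact ⟨z, G.testN_pos_of_testE hz hi, G.testN_pos_of_testE hz hk⟩
  · exact ⟨⟨r, Finset.mem_sdiff.2 ⟨hr, hrq⟩⟩, G.testN_pos_of_edge hi, G.testN_pos_of_edge hk⟩

theorem Linked.refl (x : G.q C M) : G.Linked C M x x :=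
  ⟨x, x, G.testT_pos_iff.2 .refl, .refl, G.testT_pos_iff.2 .refl⟩

/-- The end of the first walk and the start of the second are both reached from `y` through `T`.
Since `y` affects some node of `R ∖ q`, so do both of them, and this coupling joins the walks. -/
theorem Linked.trans {x y w : G.q C M} (hxy : G.Linked C M x y) (hyw : G.Linked C M y w) :
    G.Linked C M x w := by
  obtain ⟨a, b, hxa, hab, hyb⟩ := hxy
  obtain ⟨b', c, hyb', hbc, hwc⟩ := hyw
  obtain ⟨z, hz⟩ := G.exists_testE_pos y
  have h : G.Coupled C M b b' := ⟨z, G.testE_pos_trans hz hyb, G.testE_pos_trans hz hyb'⟩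
  exact ⟨a, c, hxa, (hab.tail h).trans hbc, hwc⟩

theorem Moral.linked {x y : G.q C M} (h : G.Moral C x y) : G.Linked C M x y :=
  ⟨x, y, G.testT_pos_iff.2 .refl, .single h.coupled, G.testT_pos_iff.2 .refl⟩

theorem mem_qF_iff {i : G.foster C} : i ∈ G.qF C M ↔ (i : Fin d) ∈ G.q C M := by
  rw [qF, Finset.mem_subtype]

theorem linked_of_reach {i k : G.foster C} (h : Reach (G.qF C M) (G.edgeConFF C) i k) :
    ∃ (hi : (i : Fin d) ∈ G.q C M) (hk : (k : Fin d) ∈ G.q C M), G.Linked C M ⟨i, hi⟩ ⟨k, hk⟩ := by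
  obtain ⟨hi, hk, h⟩ := h
  refine ⟨mem_qF_iff.1 hi, mem_qF_iff.1 hk, ?_⟩
  have key : ∀ y : G.qF C M, Relation.ReflTransGen
      (fun x y : G.qF C M => G.edgeConFF C x y ≠ 0) ⟨i, hi⟩ y →
      G.Linked C M ⟨i, mem_qF_iff.1 hi⟩ ⟨y.1.1, mem_qF_iff.1 y.2⟩ := by
    intro y h
    induction h with
    | refl => exact Linked.refl _
    | tail _ hbc ih => exact ih.trans (Moral.linked (moral_of_edgeConFF_ne_zero hbc))
  exact key _ h

theorem linked_of_edgeSqq_ne_zero {x y : G.q C M} (h : G.edgeSqq C M x y ≠ 0) :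
    G.Linked C M x y := by
  have h' := (partialClosure_mem_mem G.edgeConFF_nonneg G.edgeConFF_le_one
    (mem_qF_iff.2 x.2) (mem_qF_iff.2 y.2)).1 h
  exact (linked_of_reach h').2.2

/-- Converts a closure edge into positive entries of the factors of `T (EᵀE)ᵗ Eᵀ N`, the form in
which the test parameters detect it. -/
theorem exists_of_edgePqv_ne_zero {x : G.q C M} {k : G.v C M} (h : G.edgePqv C M x k ≠ 0) :
    ∃ a b z, 0 < G.testT C M x a ∧ Relation.ReflTransGen (G.Coupled C M) a b ∧
      0 < G.testE C M z b ∧ 0 < G.testN C M z k := by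
  obtain ⟨y, hxy, hyk⟩ := (partialClosure_mem_notMem G.edgeConFF_nonneg G.edgeConFF_le_one
    (mem_qF_iff.2 x.2) (fun hk => G.ne_of_mem_q_of_mem_v (mem_qF_iff.1 hk) k.2 rfl)).1 h
  obtain ⟨hx, hy, a, b, hxa, hab, hyb⟩ := linked_of_reach hxy
  have hm := moral_of_edgeConFF_ne_zero hyk
  obtain ⟨z, hzb, hzk⟩ := hm.exists_testE_testN hy k.2 hyb
  exact ⟨a, b, z, hxa, hab, hzb, hzk⟩

theorem exists_of_edgeSvv_ne_zero {i k : G.v C M} (h : G.edgeSvv C M i k ≠ 0) :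
    (∃ z, 0 < G.testN C M z i ∧ 0 < G.testN C M z k) ∨
      ∃ a b z w, (0 < G.testN C M z i ∧ 0 < G.testE C M z a) ∧
        Relation.ReflTransGen (G.Coupled C M) a b ∧
        0 < G.testE C M w b ∧ 0 < G.testN C M w k := by
  have hv : ∀ j : G.v C M, incl (G.v_subset_foster C M) j ∉ G.qF C M := fun j hj =>
    G.ne_of_mem_q_of_mem_v (mem_qF_iff.1 hj) j.2 rfl
  rcases (partialClosure_notMem_notMem G.edgeConFF_nonneg G.edgeConFF_le_one (hv i) (hv k)).1 h
    with h | ⟨x, y, hix, hxy, hyk⟩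
  · have hm := moral_of_edgeConFF_ne_zero h
    exact Or.inl (Moral.exists_testN_testN (i := i) (k := k) hm)
  · obtain ⟨hx, hy, a, b, hxa, hab, hyb⟩ := linked_of_reach hxy
    have hm := moral_of_edgeConFF_ne_zero hyk
    have hm' := (moral_of_edgeConFF_ne_zero hix).symm
    obtain ⟨w, hwb, hwk⟩ := hm.exists_testE_testN hy k.2 hyb
    obtain ⟨z, hza, hzi⟩ := hm'.exists_testE_testN hx i.2 hxa
    exact Or.inr ⟨a, b, z, w, ⟨hzi, hza⟩, hab, hwb, hwk⟩

end ParentGraph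

/-! ### Vanishing of affine expressions in the resolvent -/

section Resolvent

variable {q z m n : Type*} [Fintype q] [DecidableEq q] [Fintype z] (E : Matrix z q ℝ)
  {X : Matrix m q ℝ} {Y : Matrix q n ℝ} {i : m} {k : n} {c : ℝ}

theorem add_mul_apply_eq_zero_of_resolvent
    (h : ∀ s > 0, c + (X * resolvent E s * Y) i k = 0) : c + (X * Y) i k = 0 := by
  refine tendsto_nhds_unique ((tendsto_resolvent E X Y i k).const_add c) ?_
  refine tendsto_const_nhds.congr' ?_
  filter_upwards [self_mem_nhdsWithin] with s hs using (h s hs).symm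

/-- Let `s → 0` to remove `c`, then divide by `s`. -/
theorem eq_zero_of_add_mul_resolvent
    (h : ∀ s > 0, c + s * (X * resolvent E s * Y) i k = 0) :
    c = 0 ∧ ∀ s > 0, (X * resolvent E s * Y) i k = 0 := by
  have hc : c = 0 := by
    have h0 : Filter.Tendsto (fun s : ℝ => s) (nhdsWithin 0 (Set.Ioi 0)) (nhds 0) :=
      nhdsWithin_le_nhds
    have h1 := (h0.mul (tendsto_resolvent E X Y i k)).const_add c
    rw [zero_mul, add_zero] at h1
    refine tendsto_nhds_unique h1 (tendsto_const_nhds.congr' ?_)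
    filter_upwards [self_mem_nhdsWithin] with s hs using (h s hs).symm
  refine ⟨hc, fun s hs => ?_⟩
  have h2 := h s hs
  rw [hc, zero_add, mul_eq_zero] at h2
  exact h2.resolve_left hs.ne'

end Resolvent

namespace ParentGraph

variable {d : ℕ} (G : ParentGraph d) {C M : Finset (Fin d)}

/-! ### Edges give non-zero parameters in a test system -/

/-- After division by `s`, the entry is that of `NᵀN - s NᵀE (1 + s EᵀE)⁻¹ EᵀN`. A direct adjacency
in the concentration graph shows in the first term, a walk through `q` in the second. -/
theorem exists_sigmaVV_ne_zero {i k : G.v C M} (h : G.edgeSvv C M i k ≠ 0) :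
    ∃ s > 0, G.sigmaVV C M (G.testMatrix C M) (G.testVar C M s) i k ≠ 0 := by
  by_contra! h0
  have hNt : ∀ i z, 0 ≤ (G.testN C M)ᵀ i z := fun _ _ => G.testN_nonneg _ _
  have hEt : ∀ i z, 0 ≤ (G.testE C M)ᵀ i z := fun _ _ => G.testE_nonneg _ _
  obtain ⟨h1, h2⟩ := eq_zero_of_add_mul_resolvent (G.testE C M)
    (c := -((G.testN C M)ᵀ * G.testN C M) i k) (X := (G.testN C M)ᵀ * G.testE C M)
    (Y := (G.testE C M)ᵀ * G.testN C M) (i := i) (k := k) fun s hs => by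
      have h3 := h0 s hs
      rw [G.sigmaVV_test hs, Matrix.smul_apply, smul_eq_mul, mul_eq_zero, Matrix.sub_apply,
        Matrix.smul_apply, smul_eq_mul] at h3
      linarith [h3.resolve_left hs.ne']
  rcases exists_of_edgeSvv_ne_zero h with ⟨z, hzi, hzk⟩ | ⟨a, b, z, w, ⟨hzi, hza⟩, hab, hwb, hwk⟩
  · exact (matrix_mul_pos hNt G.testN_nonneg (j := z) hzi hzk).ne' (neg_eq_zero.1 h1)
  · obtain ⟨s, hs, hne⟩ := exists_resolvent_ne_zero (G.testE C M)
      (matrix_mul_nonneg hNt G.testE_nonneg) G.testE_nonneg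
      (matrix_mul_nonneg hEt G.testN_nonneg)
      (matrix_mul_pos hNt G.testE_nonneg (i := i) (j := z) hzi hza) hab
      (matrix_mul_pos hEt G.testN_nonneg (j := w) hwb hwk)
    exact hne (h2 s hs)

variable (C M) in
/-- `-D_uq` in the test systems. -/
def testDuq : Matrix (G.u C M) (G.q C M) ℝ :=
  -blk (G.paramD C M (G.testMatrix C M)) (G.u C M) (G.q C M)

theorem testDuq_nonneg (i : G.u C M) (x : G.q C M) : 0 ≤ G.testDuq C M i x :=
  neg_nonneg.2 (G.paramD_test_nonpos i.2
    (G.ne_of_mem_u_of_mem_right i.2 (G.mem_right_of_mem_q x.2)))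

theorem testDuq_pos {i : G.u C M} {x : G.q C M} (h : G.edgeD C M i x ≠ 0) :
    0 < G.testDuq C M i x :=
  neg_pos.2 (G.paramD_test_neg i.2
    (G.ne_of_mem_u_of_mem_right i.2 (G.mem_right_of_mem_q x.2)) h)

theorem blk_paramD_test_q :
    blk (G.paramD C M (G.testMatrix C M)) (G.u C M) (G.q C M) = -G.testDuq C M :=
  (neg_neg _).symm

/-- The constant term is `D_uv + D_uq T B`, a sum of two non-positive parts; the remainder is `s
(-D_uq) T (1 + s EᵀE)⁻¹ Eᵀ N`. An edge in `D_uv` makes the former negative, an edge through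
`P_{q|v.C}` makes the latter non-zero for some `s`. -/
theorem exists_paramHuv_ne_zero {i : G.u C M} {k : G.v C M} (h : G.edgeHuv C M i k ≠ 0) :
    ∃ s > 0, G.paramHuv C M (G.testMatrix C M) (G.testVar C M s) i k ≠ 0 := by
  by_contra! h0
  have hik := G.ne_of_mem_u_of_mem_right i.2 (G.mem_right_of_mem_v k.2)
  have hEt : ∀ i z, 0 ≤ (G.testE C M)ᵀ i z := fun _ _ => G.testE_nonneg _ _
  have hTB := matrix_mul_nonneg G.testDuq_nonneg
    (matrix_mul_nonneg G.testT_nonneg G.testB_nonneg) i k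
  have hD := G.paramD_test_nonpos i.2 hik
  obtain ⟨h1, h2⟩ := eq_zero_of_add_mul_resolvent (G.testE C M)
    (c := G.paramD C M (G.testMatrix C M) i k
      - (G.testDuq C M * (G.testT C M * G.testB C M)) i k)
    (X := G.testDuq C M * G.testT C M)
    (Y := (G.testE C M)ᵀ * G.testN C M) (i := i) (k := k) fun s hs => by
      have h3 := h0 s hs
      rw [paramHuv, G.piQV_test hs, G.blk_paramD_test_q, Matrix.neg_mul, Matrix.mul_sub,
        Matrix.mul_smul, neg_sub, Matrix.add_apply, Matrix.sub_apply, Matrix.smul_apply,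
        smul_eq_mul, blk_apply] at h3
      simp only [Matrix.mul_assoc] at h3 ⊢
      linarith
  rcases G.edgeHuv_ne_zero_iff.1 h with h | ⟨x, hx, hxk⟩
  · have := G.paramD_test_neg i.2 hik h
    linarith
  · obtain ⟨a, b, z, hxa, hab, hzb, hzk⟩ := exists_of_edgePqv_ne_zero hxk
    obtain ⟨s, hs, hne⟩ := exists_resolvent_ne_zero (G.testE C M)
      (matrix_mul_nonneg G.testDuq_nonneg G.testT_nonneg) G.testE_nonneg
      (matrix_mul_nonneg hEt G.testN_nonneg)
      (matrix_mul_pos G.testDuq_nonneg G.testT_nonneg (G.testDuq_pos hx) hxa) hab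
      (matrix_mul_pos hEt G.testN_nonneg (j := z) hzb hzk)
    exact hne (h2 s hs)

theorem blk_diagonal_testVar {a : Finset (Fin d)} (ha : ∀ i ∈ a, i ∉ G.observed C M) (s : ℝ) :
    blk (diagonal (G.testVar C M s)) a a = 1 := by
  ext i k
  rw [blk_apply]
  by_cases hik : i = k
  · subst hik
    rw [Matrix.diagonal_apply_eq, Matrix.one_apply_eq, testVar, if_neg (ha i i.2)]
  · rw [Matrix.one_apply_ne hik, Matrix.diagonal_apply_ne]
    exact fun h => hik (Subtype.ext h)

variable (C M) in
/-- `-D_up` in the test systems. -/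
def testDup : Matrix (G.u C M) (G.p C M) ℝ :=
  -blk (G.paramD C M (G.testMatrix C M)) (G.u C M) (G.p C M)

theorem testDup_nonneg (i : G.u C M) (x : G.p C M) : 0 ≤ G.testDup C M i x :=
  neg_nonneg.2 (G.paramD_test_nonpos i.2 (G.ne_of_mem_u_of_mem_p i.2 x.2))

theorem testDup_pos {i : G.u C M} {x : G.p C M} (h : G.edgeD C M i x ≠ 0) :
    0 < G.testDup C M i x :=
  neg_pos.2 (G.paramD_test_neg i.2 (G.ne_of_mem_u_of_mem_p i.2 x.2) h)

theorem paramWuu_test {s : ℝ} (hs : 0 < s) :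
    G.paramWuu C M (G.testMatrix C M) (G.testVar C M s)
      = (1 + G.testDup C M * (G.testDup C M)ᵀ)
        + G.testDuq C M * G.testT C M * resolvent (G.testE C M) s
          * (G.testDuq C M * G.testT C M)ᵀ := by
  rw [paramWuu, G.sigmaQQ_test hs, G.blk_paramD_test_q,
    show blk (G.paramD C M (G.testMatrix C M)) (G.u C M) (G.p C M) = -G.testDup C M from
      (neg_neg _).symm,
    G.blk_diagonal_testVar G.notMem_observed_of_mem_u,
    G.blk_diagonal_testVar G.notMem_observed_of_mem_p]
  simp only [Matrix.transpose_neg, Matrix.neg_mul, Matrix.mul_neg, neg_neg, Matrix.mul_one,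
    Matrix.transpose_mul, Matrix.mul_assoc]

/-- In the limit `s → 0` all three contributions are non-negative and sum to zero, so each vanishes;
this settles `i = k` and common sources in `p`. The resolvent term then vanishes for all `s`, which
a walk through `q` forbids. -/
theorem exists_paramWuu_ne_zero {i k : G.u C M} (h : G.edgeWuu C M i k ≠ 0) :
    ∃ s > 0, G.paramWuu C M (G.testMatrix C M) (G.testVar C M s) i k ≠ 0 := by
  by_contra! h0
  have h3 : ∀ s > 0, (1 + G.testDup C M * (G.testDup C M)ᵀ : Matrix _ _ ℝ) i k
      + (G.testDuq C M * G.testT C M * resolvent (G.testE C M) s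
        * (G.testDuq C M * G.testT C M)ᵀ) i k = 0 := fun s hs => by
    rw [← Matrix.add_apply, ← G.paramWuu_test hs]
    exact h0 s hs
  have hlim := add_mul_apply_eq_zero_of_resolvent (G.testE C M) h3
  have hX := matrix_mul_nonneg (G.testDuq_nonneg (C := C) (M := M)) G.testT_nonneg
  have hXt : ∀ x i, 0 ≤ (G.testDuq C M * G.testT C M)ᵀ x i := fun x i => hX i x
  have hXX := matrix_mul_nonneg hX hXt i k
  have hpt : ∀ x i, 0 ≤ (G.testDup C M)ᵀ x i := fun _ _ => G.testDup_nonneg _ _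
  have hp := matrix_mul_nonneg G.testDup_nonneg hpt i k
  have h1 : 0 ≤ (1 : Matrix (G.u C M) (G.u C M) ℝ) i k := by
    rw [Matrix.one_apply]; split_ifs <;> norm_num
  rw [Matrix.add_apply] at hlim
  rcases G.edgeWuu_ne_zero_iff.1 h with rfl | ⟨x, hix, hkx⟩ | ⟨x, y, hix, hxy, hky⟩
  · rw [Matrix.one_apply_eq] at hlim
    linarith
  · have := matrix_mul_pos G.testDup_nonneg hpt (i := i) (j := x) (k := k)
      (G.testDup_pos hix) (G.testDup_pos hkx)
    linarith
  · obtain ⟨a, b, hxa, hab, hyb⟩ := linked_of_edgeSqq_ne_zero hxy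
    obtain ⟨s, hs, hne⟩ := exists_resolvent_ne_zero (G.testE C M) hX G.testE_nonneg hXt
      (matrix_mul_pos G.testDuq_nonneg G.testT_nonneg (G.testDuq_pos hix) hxa) hab
      (k := k) (matrix_mul_pos G.testDuq_nonneg G.testT_nonneg (G.testDuq_pos hky) hyb)
    have h4 := h3 s hs
    rw [Matrix.add_apply] at h4
    exact hne (by linarith)

/-! ### The edge matrices of the summary graph -/

variable (C M)

theorem summaryGraph_Huu :
    (G.summaryGraph C M).Huu = blk (G.edgeD C M) (G.u C M) (G.u C M) := by
  have h : blk (G.edgeD C M) (G.u C M) (G.u C M)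
      = In (blk (G.edgeD C M) (G.u C M) (G.u C M)) := by
    rw [edgeD, partialClosure]
    exact congrArg (fun F => blk F (G.u C M) (G.u C M)) (In_In _).symm
  rw [h]
  refine G.structuralEdgeMatrix_eq_In (fun A δ hA i k hik => hA.edgeD_ne_zero hik)
    fun i k hik => ?_
  have hA := G.isTriangularSystem_test (C := C) (M := M) one_pos
  refine ⟨_, _, hA, ?_⟩
  -- The sign argument covers off-diagonal entries only; on the diagonal the parameter is `1`.
  by_cases heq : i = k
  · subst heq
    have h1 : G.paramHuu C M (G.testMatrix C M) i i = 1 :=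
      (hA.isGaussianSummaryModel (C := C) (M := M)).diag i
    rw [h1]
    exact one_ne_zero
  · exact (G.paramD_test_neg i.2 (fun h => heq (Subtype.ext h)) hik).ne

theorem summaryGraph_Huv : (G.summaryGraph C M).Huv = In (G.edgeHuv C M) :=
  G.structuralEdgeMatrix_eq_In (fun _ _ hA _ _ h => hA.edgeHuv_ne_zero h) fun _ _ h =>
    let ⟨_, hs, hne⟩ := G.exists_paramHuv_ne_zero h
    ⟨_, _, G.isTriangularSystem_test hs, hne⟩

theorem summaryGraph_Svv : (G.summaryGraph C M).Svv = G.edgeSvv C M := by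
  have h : G.edgeSvv C M = In (G.edgeSvv C M) := by
    rw [edgeSvv, zerConFF, partialClosure]
    exact congrArg (fun F => Matrix.submatrix F (incl (G.v_subset_foster C M))
      (incl (G.v_subset_foster C M))) (In_In _).symm
  rw [h]
  exact G.structuralEdgeMatrix_eq_In (fun _ _ hA _ _ h => hA.zerConFF_ne_zero h) fun _ _ h =>
    let ⟨_, hs, hne⟩ := G.exists_sigmaVV_ne_zero h
    ⟨_, _, G.isTriangularSystem_test hs, hne⟩

theorem summaryGraph_Wuu : (G.summaryGraph C M).Wuu = In (G.edgeWuu C M) :=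
  G.structuralEdgeMatrix_eq_In (fun _ _ hA _ _ h => hA.edgeWuu_ne_zero h) fun _ _ h =>
    let ⟨_, hs, hne⟩ := G.exists_paramWuu_ne_zero h
    ⟨_, _, G.isTriangularSystem_test hs, hne⟩

end ParentGraph

end SummaryGraph

end

theorem corollary4 {d : ℕ} (G : SummaryGraph.ParentGraph d) (C M : Finset (Fin d))
    (hCM : Disjoint C M) :
    (∀ (A : Matrix (Fin d) (Fin d) ℝ) (δ : Fin d → ℝ), G.IsTriangularSystem A δ →
      SummaryGraph.IsGaussianSummaryModel
        (SummaryGraph.condCov (SummaryGraph.cov A δ) (G.u C M) (G.v C M) C)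
        (G.paramHuu C M A) (G.paramHuv C M A δ) (G.sigmaVV C M A δ) (G.paramWuu C M A δ)) ∧
    (G.summaryGraph C M).Huu = SummaryGraph.blk (G.edgeD C M) (G.u C M) (G.u C M) ∧
    (G.summaryGraph C M).Huv = SummaryGraph.In
      (SummaryGraph.blk (G.edgeD C M) (G.u C M) (G.v C M)
        + SummaryGraph.blk (G.edgeD C M) (G.u C M) (G.q C M) * G.edgePqv C M) ∧
    (G.summaryGraph C M).Svv = G.edgeSvv C M ∧
    (G.summaryGraph C M).Wuu = SummaryGraph.In
      ((1 + SummaryGraph.blk (G.edgeD C M) (G.u C M) (G.p C M)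
          * (SummaryGraph.blk (G.edgeD C M) (G.u C M) (G.p C M)).transpose)
        + SummaryGraph.blk (G.edgeD C M) (G.u C M) (G.q C M) * G.edgeSqq C M
          * (SummaryGraph.blk (G.edgeD C M) (G.u C M) (G.q C M)).transpose) :=
  ⟨fun _ _ hA => hA.isGaussianSummaryModel, G.summaryGraph_Huu C M, G.summaryGraph_Huv C M,
    G.summaryGraph_Svv C M, G.summaryGraph_Wuu C M⟩
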